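/- Let $E$ be a finite-dimensional real Banach space and let $C\subseteq E$ be an open convex cone (closed under addition and under multiplication by positive scalars) whose closure satisfies $\overline C\cap(-\overline C)=\{0\}$. Order $C$ by $x\le y$ iff $y-x\in\overline C$, and let $d_T(x,y)=\max\{\log M(x/y),\log M(y/x)\}$, with $M(x/y)=\inf\{\lambda>0: x\le\lambda y\}$, be the Thompson metric on $C$ (if $E=\{0\}$, put $d_T=0$). Let $\mathcal P(C)$ be the set of Borel probability measures on $C$, with the stochastic order: $\mu\le\nu$ iff $\mu(U)\le\nu(U)$ for every open upper set $U\subseteq C$. For real $p\ge1$ let $\mathcal P^p(C)$ be the set of $\mu\in\mathcal P(C)$ with $\int_C d_T(x,y)^p\,d\mu(y)<\infty$ for all $x\in C$, with the $p$-Wasserstein metric $d_p^W(\mu,\nu)=\bigl[\inf_\pi\int_{C\times C}d_T(x,y)^p\,d\pi(x,y)\bigr]^{1/p}$, where $\pi$ runs over the probability measures on $C\times C$ with marginals $\mu$ and $\nu$. Let $\mu,\mu_n\in\mathcal P(C)$, $n\in\mathbb N$. Then the following are equivalent: (i) $\mu_1\le\mu_2\le\cdots$ (resp. $\mu_1\ge\mu_2\ge\cdots$)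 in the stochastic order and $\mu_n\to\mu$ weakly; (ii) for every bounded continuous function $f:C\to[0,\infty)$ that is monotone (i.e. $x\le y$ implies $f(x)\le f(y)$), the sequence $\int_C f\,d\mu_n$ is increasing (resp. decreasing), in the non-strict sense, and converges to $\int_C f\,d\mu$. Moreover, if $1\le p<\infty$ and $\mu,\mu_n\in\mathcal P^p(C)$ for all $n$, then (i) and (ii) are also equivalent to: (iii) $\mu_1\le\mu_2\le\cdots$ (resp. $\mu_1\ge\mu_2\ge\cdots$) in the stochastic order and $d_p^W(\mu_n,\mu)\to0$. -/

import Mathlib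

open Filter Topology MeasureTheory
open scoped ENNReal BoundedContinuousFunction

noncomputable section

namespace ConeOrder

variable {E : Type*} [NormedAddCommGroup E] [NormedSpace ℝ E]

/-- The closed partial order defined by the closure of an (open) convex cone `C`:
`x ≤ y` iff `y - x ∈ closure C`. -/
def ConeLE (C : ConvexCone ℝ E) (x y : E) : Prop :=
  y - x ∈ closure (C : Set E)

/-- `A ⊆ C` is an upper set: `x ∈ A`, `x ≤ y`, `y ∈ C` imply `y ∈ A`. -/
def IsConeUpper (C : ConvexCone ℝ E) (A : Set C) : Prop :=
  ∀ ⦃x y : C⦄, ConeLE C (x : E) (y : E) → x ∈ A → y ∈ A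

/-- `f : C → ℝ` is monotone for the cone order. -/
def IsConeMonotone (C : ConvexCone ℝ E) (f : C → ℝ) : Prop :=
  ∀ ⦃x y : C⦄, ConeLE C (x : E) (y : E) → f x ≤ f y

/-- `M(x/y) = inf {r > 0 : x ≤ r y}`. -/
def gaugeM (C : ConvexCone ℝ E) (x y : E) : ℝ :=
  sInf {r : ℝ | 0 < r ∧ ConeLE C x (r • y)}

/-- The Thompson part metric `d_T(x,y) = max {log M(x/y), log M(y/x)}` on `C`. -/
def thompsonDist (C : ConvexCone ℝ E) (x y : C) : ℝ :=
  max (Real.log (gaugeM C (x : E) (y : E))) (Real.log (gaugeM C (y : E) (x : E)))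

variable [MeasurableSpace E]

/-- The stochastic order: `μ U ≤ ν U` for every open upper set `U` of `C`. -/
def StochLE (C : ConvexCone ℝ E) (μ ν : ProbabilityMeasure C) : Prop :=
  ∀ U : Set C, IsOpen U → IsConeUpper C U → (μ : Measure C) U ≤ (ν : Measure C) U

/-- `μ` has finite `p`-th moment with respect to the Thompson metric. -/
def HasFiniteMoment (C : ConvexCone ℝ E) (p : ℝ) (μ : ProbabilityMeasure C) : Prop :=
  ∀ x : C, ∫⁻ y, ENNReal.ofReal (thompsonDist C x y) ^ p ∂(μ : Measure C) < ∞

/-- The couplings of `μ` and `ν`: probability measures on `C × C` with marginals `μ`, `ν`. -/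
def couplings (C : ConvexCone ℝ E) (μ ν : ProbabilityMeasure C) :
    Set (ProbabilityMeasure (C × C)) :=
  {π | (π : Measure (C × C)).map Prod.fst = (μ : Measure C) ∧
       (π : Measure (C × C)).map Prod.snd = (ν : Measure C)}

/-- The `p`-Wasserstein distance for the Thompson metric, with values in `[0, ∞]`
(it is finite on measures with finite `p`-th moment). -/
def wassersteinDist (C : ConvexCone ℝ E) (p : ℝ) (μ ν : ProbabilityMeasure C) : ℝ≥0∞ :=
  (⨅ π ∈ couplings C μ ν,
    ∫⁻ z, ENNReal.ofReal (thompsonDist C z.1 z.2) ^ p ∂(π : Measure (C × C))) ^ (1 / p)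

end ConeOrder

end

/-! The Thompson metric is the symmetrisation of the Funk distance `funkDist`, the positive part of
log M(x/y). It satisfies the triangle inequality, vanishes exactly when x ≤ y, and hence is monotone
in its first and antitone in its second variable. So the order, the topology and the metric are all
controlled by monotone functions.

Truncated multiples of the Funk distance to a closed lower set increase to the indicator of its
complement, so nonnegative bounded continuous monotone functions determine the stochastic order
(`stochLE_of_integral_le`). The layer-cake formula gives the opposite direction.

A monotone sequence with its limit lies stochastically between two fixed measures. Thompson balls
are compact, and the complement of such a ball is a union of an upper set and a lower set defined by
Funk distances, so the two bounding measures give tightness (`isTightMeasureSet_of_stochLE`).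
Monotone functions generate a point-separating algebra, and with tightness convergence of their
integrals becomes weak convergence (`tendsto_of_tendsto_integral_monotone`).

For Wasserstein convergence the same bounds make the tails of d_T^p uniformly small
(`exists_uniform_tail`). A partition of unity subordinate to small balls then yields an explicit
coupling of small cost (`exists_coupling_lintegral_le`, `eventually_exists_coupling`). Conversely,
Markov's inequality and the portmanteau theorem recover weak convergence
(`tendsto_of_tendsto_wassersteinDist`). -/

noncomputable section

namespace ConeOrder

/-! ### Cone order, Funk distance and Thompson metric -/

section Geometry

variable {E : Type*} [NormedAddCommGroup E] [NormedSpace ℝ E]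

/-- An open convex cone whose closure contains `0` and is salient. -/
structure IsProperOpen (C : ConvexCone ℝ E) : Prop where
  isOpen : IsOpen (C : Set E)
  zero_mem : (0 : E) ∈ closure (C : Set E)
  eq_zero : ∀ x : E, x ∈ closure (C : Set E) → -x ∈ closure (C : Set E) → x = 0

variable {C : ConvexCone ℝ E}

theorem add_mem_closure {x y : E} (hx : x ∈ closure (C : Set E)) (hy : y ∈ closure (C : Set E)) :
    x + y ∈ closure (C : Set E) :=
  C.closure.add_mem' hx hy

theorem smul_mem_closure (hC : IsProperOpen C) {r : ℝ} (hr : 0 ≤ r) {x : E}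
    (hx : x ∈ closure (C : Set E)) : r • x ∈ closure (C : Set E) := by
  rcases hr.eq_or_lt with rfl | h
  · simpa using hC.zero_mem
  · exact C.closure.smul_mem' h hx

-- For an open set, adding the closure of a set gives the same as adding the set itself, and C + C
-- lies in C.
open scoped Pointwise in
theorem IsProperOpen.add_closure_mem (hC : IsProperOpen C) {x y : E} (hx : x ∈ C)
    (hy : y ∈ closure (C : Set E)) : x + y ∈ C := by
  have h : x + y ∈ (C : Set E) + closure (C : Set E) := Set.add_mem_add hx hy
  rw [hC.isOpen.add_closure] at h
  obtain ⟨a, ha, b, hb, hab⟩ := h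
  exact hab ▸ C.add_mem' ha hb

theorem ConeLE.trans {x y z : E} (h : ConeLE C x y) (h' : ConeLE C y z) : ConeLE C x z := by
  have := add_mem_closure h' h
  rwa [sub_add_sub_cancel] at this

theorem ConeLE.refl (hC : IsProperOpen C) (x : E) : ConeLE C x x := by
  simpa [ConeLE] using hC.zero_mem

theorem ConeLE.smul (hC : IsProperOpen C) {x y : E} (h : ConeLE C x y) {r : ℝ} (hr : 0 ≤ r) :
    ConeLE C (r • x) (r • y) := by
  have := smul_mem_closure hC hr h
  rwa [smul_sub] at this

theorem ConeLE.smul_left_iff (hC : IsProperOpen C) {x y : E} {r : ℝ} (hr : 0 < r) :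
    ConeLE C (r • x) y ↔ ConeLE C x (r⁻¹ • y) := by
  constructor
  · intro h
    simpa [smul_smul, inv_mul_cancel₀ hr.ne'] using h.smul hC (inv_nonneg.2 hr.le)
  · intro h
    simpa [smul_smul, mul_inv_cancel₀ hr.ne'] using h.smul hC hr.le

theorem ConeLE.smul_le_smul (hC : IsProperOpen C) {x : E} (hx : x ∈ C) {r s : ℝ} (h : r ≤ s) :
    ConeLE C (r • x) (s • x) := by
  have := smul_mem_closure hC (sub_nonneg.2 h) (subset_closure hx)
  rwa [sub_smul] at this

theorem gaugeM_nonneg (x y : E) : 0 ≤ gaugeM C x y :=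
  Real.sInf_nonneg fun _ h => h.1.le

theorem gaugeM_le {x y : E} {r : ℝ} (hr : 0 < r) (h : ConeLE C x (r • y)) : gaugeM C x y ≤ r :=
  csInf_le ⟨0, fun _ h => h.1.le⟩ ⟨hr, h⟩

/-- Since y is interior, y - t x stays in C for small t > 0; then r = 1/t works. Thus the infimum
defining M(x/y) runs over a nonempty set. -/
theorem IsProperOpen.exists_coneLE_smul (hC : IsProperOpen C) (x : E) {y : E} (hy : y ∈ C) :
    ∃ r : ℝ, 0 < r ∧ ConeLE C x (r • y) := by
  have hcont : Tendsto (fun t : ℝ => y - t • x) (𝓝 0) (𝓝 (y - (0 : ℝ) • x)) :=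
    Continuous.tendsto (by fun_prop) 0
  rw [zero_smul, sub_zero] at hcont
  have hev := hcont.eventually (hC.isOpen.mem_nhds hy)
  obtain ⟨t, ht, htC⟩ :=
    ((eventually_nhdsWithin_of_eventually_nhds hev).and
      (self_mem_nhdsWithin (s := Set.Ioi (0 : ℝ)))).exists
  have htC : 0 < t := htC
  refine ⟨t⁻¹, inv_pos.2 htC, ?_⟩
  rw [← ConeLE.smul_left_iff hC htC]
  exact subset_closure ht

theorem coneLE_smul_of_gaugeM_lt (hC : IsProperOpen C) {x y : E} (hy : y ∈ C) {r : ℝ}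
    (h : gaugeM C x y < r) : ConeLE C x (r • y) := by
  obtain ⟨s, ⟨_, hs⟩, hsr⟩ := exists_lt_of_csInf_lt
    (s := {r : ℝ | 0 < r ∧ ConeLE C x (r • y)}) (hC.exists_coneLE_smul x hy) h
  exact hs.trans (ConeLE.smul_le_smul hC hy hsr.le)

theorem coneLE_smul_of_gaugeM_le (hC : IsProperOpen C) {x y : E} (hy : y ∈ C) {r : ℝ}
    (h : gaugeM C x y ≤ r) : ConeLE C x (r • y) := by
  have hcont : Tendsto (fun s : ℝ => s • y - x) (𝓝[>] r) (𝓝 (r • y - x)) :=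
    (Continuous.tendsto (by fun_prop) r).mono_left nhdsWithin_le_nhds
  refine isClosed_closure.mem_of_tendsto hcont ?_
  filter_upwards [self_mem_nhdsWithin] with s hs
  exact coneLE_smul_of_gaugeM_lt hC hy (h.trans_lt hs)

/-- The asymmetric (Funk) distance `log⁺ M(x/y)`. -/
def funkDist (C : ConvexCone ℝ E) (x y : C) : ℝ :=
  max 0 (Real.log (gaugeM C (x : E) (y : E)))

theorem funkDist_nonneg (x y : C) : 0 ≤ funkDist C x y := le_max_left _ _

/-- Reduces statements about logarithms of gauges to order inequalities; most later Funk estimates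
pass through it. The case M = 0 is treated apart because there the logarithm has the default value
0. -/
theorem funkDist_le_iff (hC : IsProperOpen C) {x y : C} {t : ℝ} (ht : 0 ≤ t) :
    funkDist C x y ≤ t ↔ ConeLE C (x : E) (Real.exp t • (y : E)) := by
  have h0 := gaugeM_nonneg (C := C) (x : E) (y : E)
  constructor
  · intro h
    apply coneLE_smul_of_gaugeM_le hC y.2
    rcases h0.eq_or_lt with h1 | h1
    · rw [← h1]; positivity
    · exact (Real.log_le_iff_le_exp h1).1 ((le_max_right _ _).trans h)
  · intro h
    refine max_le ht ?_
    have h2 := gaugeM_le (Real.exp_pos t) h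
    rcases h0.eq_or_lt with h1 | h1
    · rw [← h1]; simpa using ht
    · exact (Real.log_le_iff_le_exp h1).2 h2

theorem coneLE_funkDist (hC : IsProperOpen C) (x y : C) :
    ConeLE C (x : E) (Real.exp (funkDist C x y) • (y : E)) :=
  (funkDist_le_iff hC (funkDist_nonneg x y)).1 le_rfl

theorem funkDist_eq_zero_iff (hC : IsProperOpen C) {x y : C} :
    funkDist C x y = 0 ↔ ConeLE C (x : E) (y : E) := by
  rw [← (funkDist_nonneg x y).ge_iff_eq', funkDist_le_iff hC le_rfl, Real.exp_zero, one_smul]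

theorem funkDist_triangle (hC : IsProperOpen C) (x y z : C) :
    funkDist C x z ≤ funkDist C x y + funkDist C y z := by
  rw [funkDist_le_iff hC (add_nonneg (funkDist_nonneg _ _) (funkDist_nonneg _ _)), Real.exp_add,
    mul_smul]
  exact (coneLE_funkDist hC x y).trans ((coneLE_funkDist hC y z).smul hC (Real.exp_pos _).le)

theorem funkDist_self (hC : IsProperOpen C) (x : C) : funkDist C x x = 0 :=
  (funkDist_eq_zero_iff hC).2 (ConeLE.refl hC _)

/-- The triangle inequality with first leg 0. This and its dual link the metric to the order. -/
theorem funkDist_mono_left (hC : IsProperOpen C) {x y : C} (h : ConeLE C (x : E) (y : E)) (z : C) :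
    funkDist C x z ≤ funkDist C y z := by
  simpa [(funkDist_eq_zero_iff hC).2 h] using funkDist_triangle hC x y z

theorem funkDist_anti_right (hC : IsProperOpen C) {x y : C} (h : ConeLE C (x : E) (y : E))
    (z : C) : funkDist C z y ≤ funkDist C z x := by
  simpa [(funkDist_eq_zero_iff hC).2 h] using funkDist_triangle hC z x y

theorem eventually_funkDist_le (hC : IsProperOpen C) (y : C) {ε : ℝ} (hε : 0 < ε) :
    ∀ᶠ x in 𝓝 y, funkDist C x y ≤ ε ∧ funkDist C y x ≤ ε := by
  have key : (Real.exp ε • (y : E) - (y : E)) ∈ C := by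
    rw [← one_smul ℝ (y : E), smul_smul, mul_one, ← sub_smul]
    exact C.smul_mem' (by simpa using hε) y.2
  have h1 : Tendsto (fun x : C => Real.exp ε • (y : E) - (x : E)) (𝓝 y)
      (𝓝 (Real.exp ε • (y : E) - (y : E))) := Continuous.tendsto (by fun_prop) y
  have h2 : Tendsto (fun x : C => Real.exp ε • (x : E) - (y : E)) (𝓝 y)
      (𝓝 (Real.exp ε • (y : E) - (y : E))) := Continuous.tendsto (by fun_prop) y
  filter_upwards [h1.eventually (hC.isOpen.mem_nhds key),
    h2.eventually (hC.isOpen.mem_nhds key)] with x hx hx'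
  exact ⟨(funkDist_le_iff hC hε.le).2 (subset_closure hx),
    (funkDist_le_iff hC hε.le).2 (subset_closure hx')⟩

/-- A function which is `1`-Lipschitz for the Funk distance is continuous. -/
theorem continuous_of_le_funkDist_add (hC : IsProperOpen C) {f : C → ℝ}
    (hf : ∀ x y, f x ≤ funkDist C x y + f y) : Continuous f := by
  refine continuous_iff_continuousAt.2 fun y => Metric.tendsto_nhds.2 fun ε hε => ?_
  filter_upwards [eventually_funkDist_le hC y (half_pos hε)] with x hx
  rw [Real.dist_eq, abs_lt]
  constructor <;> linarith [hf x y, hf y x]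

theorem continuous_funkDist_left (hC : IsProperOpen C) (z : C) :
    Continuous fun x => funkDist C x z :=
  continuous_of_le_funkDist_add hC fun x y => funkDist_triangle hC x y z

theorem continuous_funkDist_right (hC : IsProperOpen C) (z : C) :
    Continuous fun x => funkDist C z x := by
  refine continuous_iff_continuousAt.2 fun y => Metric.tendsto_nhds.2 fun ε hε => ?_
  filter_upwards [eventually_funkDist_le hC y (half_pos hε)] with x hx
  rw [Real.dist_eq, abs_lt]
  constructor <;> linarith [funkDist_triangle hC z x y, funkDist_triangle hC z y x]

/-- The truncation at 0 changes nothing because the two logarithms cannot both be negative. With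
M(x/y) and M(y/x) below 1 one gets x ≤ r x for some r < 1, hence -x is in the closure and x = 0.
Then M(x/y) = 0, whose logarithm is 0, a contradiction. This also covers the degenerate case E =
{0}. -/
theorem thompsonDist_eq_max_funkDist (hC : IsProperOpen C) (x y : C) :
    thompsonDist C x y = max (funkDist C x y) (funkDist C y x) := by
  suffices h : 0 ≤ thompsonDist C x y by
    unfold funkDist
    rw [max_max_max_comm, max_self]
    exact (max_eq_right h).symm
  by_contra! hlt
  obtain ⟨h1, h2⟩ := max_lt_iff.1 hlt
  have g1 := gaugeM_nonneg (C := C) (x : E) (y : E)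
  have g2 := gaugeM_nonneg (C := C) (y : E) (x : E)
  have l1 := (Real.log_neg_iff (g1.lt_of_ne fun h => by simp [← h] at h1)).1 h1
  have p2 := g2.lt_of_ne fun h => by simp [← h] at h2
  have l2 := (Real.log_neg_iff p2).1 h2
  have k1 := coneLE_smul_of_gaugeM_le hC y.2 (le_refl (gaugeM C (x : E) (y : E)))
  have k2 := coneLE_smul_of_gaugeM_le hC x.2 (le_refl (gaugeM C (y : E) (x : E)))
  have k3 := k1.trans (k2.smul hC g1)
  rw [smul_smul] at k3
  have hx0 : (x : E) = 0 := by
    refine hC.eq_zero _ (subset_closure x.2) ?_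
    have hpos : 0 < 1 - gaugeM C (x : E) (y : E) * gaugeM C (y : E) (x : E) := by nlinarith
    have := smul_mem_closure hC (inv_nonneg.2 hpos.le) k3
    convert this using 1
    rw [show ∀ r : ℝ, r • (x : E) - (x : E) = -((1 - r) • (x : E)) from
      fun r => by rw [sub_smul, one_smul, neg_sub], smul_neg, smul_smul,
      inv_mul_cancel₀ hpos.ne', one_smul]
  have hz : gaugeM C (x : E) (y : E) = 0 := by
    refine le_antisymm (le_of_forall_pos_le_add fun ε hε => ?_) g1
    rw [zero_add]
    refine gaugeM_le hε ?_
    rw [hx0, ConeLE, sub_zero]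
    exact subset_closure (C.smul_mem' hε y.2)
  simp [hz] at h1

theorem thompsonDist_nonneg (hC : IsProperOpen C) (x y : C) : 0 ≤ thompsonDist C x y := by
  rw [thompsonDist_eq_max_funkDist hC]
  exact (funkDist_nonneg x y).trans (le_max_left _ _)

theorem thompsonDist_self (hC : IsProperOpen C) (x : C) : thompsonDist C x x = 0 := by
  rw [thompsonDist_eq_max_funkDist hC, funkDist_self hC, max_self]

theorem thompsonDist_comm (x y : C) : thompsonDist C x y = thompsonDist C y x := max_comm _ _

theorem thompsonDist_triangle (hC : IsProperOpen C) (x y z : C) :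
    thompsonDist C x z ≤ thompsonDist C x y + thompsonDist C y z := by
  simp only [thompsonDist_eq_max_funkDist hC]
  refine max_le ((funkDist_triangle hC x y z).trans ?_) ((funkDist_triangle hC z y x).trans ?_)
  · exact add_le_add (le_max_left _ _) (le_max_left _ _)
  · rw [add_comm]
    exact add_le_add (le_max_right _ _) (le_max_right _ _)

theorem eventually_thompsonDist_lt (hC : IsProperOpen C) (y : C) {ε : ℝ} (hε : 0 < ε) :
    ∀ᶠ x in 𝓝 y, thompsonDist C x y < ε := by
  filter_upwards [eventually_funkDist_le hC y (half_pos hε)] with x hx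
  rw [thompsonDist_eq_max_funkDist hC]
  exact (max_le hx.1 hx.2).trans_lt (half_lt_self hε)

theorem continuous_thompsonDist (hC : IsProperOpen C) :
    Continuous fun z : C × C => thompsonDist C z.1 z.2 := by
  refine continuous_iff_continuousAt.2 fun y => Metric.tendsto_nhds.2 fun ε hε => ?_
  filter_upwards [(eventually_thompsonDist_lt hC y.1 (half_pos hε)).prod_inl_nhds y.2,
    (eventually_thompsonDist_lt hC y.2 (half_pos hε)).prod_inr_nhds y.1] with x h1 h2
  rw [Real.dist_eq, abs_lt]
  constructor <;>
    linarith [thompsonDist_triangle hC x.1 y.1 x.2, thompsonDist_triangle hC y.1 y.2 x.2,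
      thompsonDist_triangle hC y.1 x.1 y.2, thompsonDist_triangle hC x.1 x.2 y.2,
      thompsonDist_comm (C := C) x.1 y.1, thompsonDist_comm (C := C) x.2 y.2]

theorem continuous_thompsonDist_right (hC : IsProperOpen C) (x : C) :
    Continuous fun y => thompsonDist C x y :=
  Continuous.comp (g := fun z : C × C => thompsonDist C z.1 z.2) (f := fun y => (x, y))
    (continuous_thompsonDist hC) (by fun_prop)

theorem continuous_thompsonDist_left (hC : IsProperOpen C) (y : C) :
    Continuous fun x => thompsonDist C x y :=
  Continuous.comp (g := fun z : C × C => thompsonDist C z.1 z.2) (f := fun x => (x, y))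
    (continuous_thompsonDist hC) (by fun_prop)

/-- A proper cone in finite dimension is normal: order intervals are bounded. -/
theorem IsProperOpen.isBounded_coneLE [FiniteDimensional ℝ E] (hC : IsProperOpen C) (v : E) :
    Bornology.IsBounded {z : E | z ∈ closure (C : Set E) ∧ ConeLE C z v} := by
  have hS : IsCompact (Metric.sphere (0 : E) 1 ∩ closure (C : Set E)) :=
    (isCompact_sphere 0 1).inter_right isClosed_closure
  rcases (Metric.sphere (0 : E) 1 ∩ closure (C : Set E)).eq_empty_or_nonempty with he | hne
  · refine (Bornology.isBounded_singleton (x := (0 : E))).subset fun z hz => ?_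
    by_contra h0
    have h0 : z ≠ 0 := h0
    have : ‖z‖⁻¹ • z ∈ Metric.sphere (0 : E) 1 ∩ closure (C : Set E) :=
      ⟨by simp [norm_smul, h0], smul_mem_closure hC (by positivity) hz.1⟩
    simp [he] at this
  -- By compactness and salience, the distance from -z to the closed cone has a positive minimum δ
  -- over unit vectors z of the cone. For z ≤ v the cone element (v - z)/‖z‖ is at distance ‖v‖/‖z‖
  -- from -z/‖z‖, so ‖z‖ ≤ ‖v‖/δ.
  · obtain ⟨w, ⟨hw1, hw2⟩, hmin⟩ := hS.exists_isMinOn hne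
      (f := fun z => Metric.infDist (-z) (closure (C : Set E)))
      ((Metric.continuous_infDist_pt _).comp continuous_neg).continuousOn
    have hpos : 0 < Metric.infDist (-w) (closure (C : Set E)) := by
      rw [← isClosed_closure.notMem_iff_infDist_pos ⟨0, hC.zero_mem⟩]
      intro h
      have := hC.eq_zero w hw2 h
      simp [this] at hw1
    refine isBounded_iff_forall_norm_le.2
      ⟨‖v‖ / Metric.infDist (-w) (closure (C : Set E)), fun z hz => ?_⟩
    rcases eq_or_ne z 0 with rfl | h0
    · simp; positivity
    have hn : 0 < ‖z‖ := norm_pos_iff.2 h0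
    have h1 : ‖z‖⁻¹ • z ∈ Metric.sphere (0 : E) 1 ∩ closure (C : Set E) :=
      ⟨by simp [norm_smul, h0], smul_mem_closure hC (by positivity) hz.1⟩
    have h2 : ‖z‖⁻¹ • (v - z) ∈ closure (C : Set E) := smul_mem_closure hC (by positivity) hz.2
    have h3 := (hmin h1).trans (Metric.infDist_le_dist_of_mem h2)
    rw [dist_eq_norm, smul_sub,
      show -(‖z‖⁻¹ • z) - (‖z‖⁻¹ • v - ‖z‖⁻¹ • z) = -(‖z‖⁻¹ • v) by abel,
      norm_neg, norm_smul, norm_inv, norm_norm] at h3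
    rw [le_div_iff₀ hpos, mul_comm, ← le_div_iff₀ hn]
    rwa [div_eq_inv_mul]

theorem isCompact_funkDist_le [FiniteDimensional ℝ E] (hC : IsProperOpen C) (u : C) {R : ℝ}
    (hR : 0 ≤ R) : IsCompact {z : C | funkDist C z u ≤ R ∧ funkDist C u z ≤ R} := by
  have hcl : IsClosed {z : E | ConeLE C z (Real.exp R • (u : E)) ∧
      ConeLE C (u : E) (Real.exp R • z)} :=
    (isClosed_closure.preimage (by fun_prop : Continuous fun z : E => Real.exp R • (u : E) - z)).inter
      (isClosed_closure.preimage (by fun_prop : Continuous fun z : E => Real.exp R • z - (u : E)))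
  -- The lower bound keeps z away from the boundary of C, so the ball is closed in E and not only in
  -- C.
  have hmem : ∀ z : E, ConeLE C (u : E) (Real.exp R • z) → z ∈ C := by
    intro z hz
    have h1 : Real.exp R • z ∈ C := by
      simpa using hC.add_closure_mem u.2 hz
    have := C.smul_mem' (inv_pos.2 (Real.exp_pos R)) h1
    rwa [smul_smul, inv_mul_cancel₀ (Real.exp_pos R).ne', one_smul] at this
  have hcomp : IsCompact {z : E | ConeLE C z (Real.exp R • (u : E)) ∧
      ConeLE C (u : E) (Real.exp R • z)} :=
    Metric.isCompact_of_isClosed_isBounded hcl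
      ((hC.isBounded_coneLE (Real.exp R • (u : E))).subset fun z hz =>
        ⟨subset_closure (hmem z hz.2), hz.1⟩)
  rw [Subtype.isCompact_iff]
  convert hcomp using 1
  ext z
  constructor
  · rintro ⟨w, ⟨h1, h2⟩, rfl⟩
    exact ⟨(funkDist_le_iff hC hR).1 h1, (funkDist_le_iff hC hR).1 h2⟩
  · rintro ⟨h1, h2⟩
    exact ⟨⟨z, hmem z h2⟩, ⟨(funkDist_le_iff hC hR).2 h1, (funkDist_le_iff hC hR).2 h2⟩, rfl⟩

/-- The Thompson metric induces a topology at least as fine as the given one. -/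
theorem exists_pos_le_thompsonDist [FiniteDimensional ℝ E] (hC : IsProperOpen C) {G : Set C}
    (hG : IsOpen G) {x : C} (hx : x ∈ G) : ∃ ε : ℝ, 0 < ε ∧ ∀ y ∉ G, ε ≤ thompsonDist C x y := by
  have hc : Continuous fun y => thompsonDist C x y :=
    continuous_thompsonDist_right hC x
  -- Points outside the unit Thompson ball are at distance at least 1; on the compact rest of the
  -- complement of G the continuous distance to x attains a positive minimum.
  have hK : IsCompact ({z : C | funkDist C z x ≤ 1 ∧ funkDist C x z ≤ 1} ∩ Gᶜ) :=
    (isCompact_funkDist_le hC x zero_le_one).inter_right hG.isClosed_compl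
  have hout : ∀ y ∉ G, y ∉ {z : C | funkDist C z x ≤ 1 ∧ funkDist C x z ≤ 1} ∩ Gᶜ →
      1 ≤ thompsonDist C x y := by
    intro y hy hyK
    by_contra! hlt
    rw [thompsonDist_eq_max_funkDist hC, max_lt_iff] at hlt
    exact hyK ⟨⟨hlt.2.le, hlt.1.le⟩, hy⟩
  rcases Set.eq_empty_or_nonempty ({z : C | funkDist C z x ≤ 1 ∧ funkDist C x z ≤ 1} ∩ Gᶜ)
    with he | hne
  · exact ⟨1, one_pos, fun y hy => hout y hy (by simp [he])⟩
  · obtain ⟨w, hw, hmin⟩ := hK.exists_isMinOn hne hc.continuousOn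
    have hpos : 0 < thompsonDist C x w := by
      refine (thompsonDist_nonneg hC x w).lt_of_ne fun h => hw.2 ?_
      have hle : funkDist C x w ≤ 0 ∧ funkDist C w x ≤ 0 := by
        rw [← max_le_iff, ← thompsonDist_eq_max_funkDist hC, ← h]
      have h1 := (funkDist_eq_zero_iff hC).1 (le_antisymm hle.1 (funkDist_nonneg _ _))
      have h2 := (funkDist_eq_zero_iff hC).1 (le_antisymm hle.2 (funkDist_nonneg _ _))
      have h3 := hC.eq_zero ((w : E) - x) h1 (by rw [neg_sub]; exact h2)
      rwa [Subtype.ext (sub_eq_zero.1 h3)]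
    refine ⟨min 1 (thompsonDist C x w), lt_min one_pos hpos, fun y hy => ?_⟩
    by_cases hyK : y ∈ {z : C | funkDist C z x ≤ 1 ∧ funkDist C x z ≤ 1} ∩ Gᶜ
    · exact (min_le_right _ _).trans (hmin hyK)
    · exact (min_le_left _ _).trans (hout y hy hyK)

end Geometry

/-! ### Funk distance to a set -/

section InfFunkDist

variable {E : Type*} [NormedAddCommGroup E] [NormedSpace ℝ E] {C : ConvexCone ℝ E}

/-- The Funk distance from a point to a set of points. -/
def infFunkDist (C : ConvexCone ℝ E) (L : Set C) (x : C) : ℝ := ⨅ z : L, funkDist C x z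

theorem infFunkDist_le {L : Set C} (x : C) {z : C} (hz : z ∈ L) :
    infFunkDist C L x ≤ funkDist C x z :=
  ciInf_le (f := fun z : L => funkDist C x z)
    ⟨0, by rintro _ ⟨w, rfl⟩; exact funkDist_nonneg _ _⟩ ⟨z, hz⟩

theorem infFunkDist_nonneg {L : Set C} (x : C) : 0 ≤ infFunkDist C L x :=
  Real.iInf_nonneg fun _ => funkDist_nonneg _ _

theorem infFunkDist_le_add (hC : IsProperOpen C) (L : Set C) (x y : C) :
    infFunkDist C L x ≤ funkDist C x y + infFunkDist C L y := by
  -- For empty L the real infimum has the default value 0.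
  rcases L.eq_empty_or_nonempty with rfl | hL
  · simpa [infFunkDist] using funkDist_nonneg x y
  have : Nonempty L := hL.to_subtype
  rw [← sub_le_iff_le_add']
  refine le_ciInf fun z => ?_
  rw [sub_le_iff_le_add']
  exact (infFunkDist_le x z.2).trans (funkDist_triangle hC x y z)

theorem infFunkDist_mono (hC : IsProperOpen C) (L : Set C) :
    IsConeMonotone C (infFunkDist C L) := fun x y h => by
  simpa [(funkDist_eq_zero_iff hC).2 h] using infFunkDist_le_add hC L x y

/-- The truncation at `1` of a nonnegative continuous function, as a bounded function. -/
def truncOne (f : C → ℝ) (hf : Continuous f) (h0 : ∀ x, 0 ≤ f x) : C →ᵇ ℝ :=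
  BoundedContinuousFunction.ofNormedAddCommGroup (fun x => min 1 (f x))
    (continuous_const.min hf) 1 fun x => by
      rw [Real.norm_of_nonneg (le_min zero_le_one (h0 x))]; exact min_le_left _ _

/-- If the distance were 0, some point of L would dominate exp(-1/(k+1)) x for each k. As L is a
lower set it contains these multiples, and as it is closed it contains their limit x. -/
theorem infFunkDist_pos (hC : IsProperOpen C) {L : Set C} (hL : IsClosed L) (hne : L.Nonempty)
    (hlow : IsConeUpper C Lᶜ) {x : C} (hx : x ∉ L) : 0 < infFunkDist C L x := by
  have : Nonempty L := hne.to_subtype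
  refine (infFunkDist_nonneg x).lt_of_ne fun h => hx ?_
  have hlim : Tendsto (fun k : ℕ => Real.exp (-(1 / ((k : ℝ) + 1)))) atTop (𝓝 1) := by
    have := (Real.continuous_exp.tendsto _).comp
      (tendsto_one_div_add_atTop_nhds_zero_nat (𝕜 := ℝ)).neg
    rwa [neg_zero, Real.exp_zero] at this
  refine hL.mem_of_tendsto (b := atTop) (f := fun k : ℕ =>
    (⟨Real.exp (-(1 / ((k : ℝ) + 1))) • (x : E), C.smul_mem' (Real.exp_pos _) x.2⟩ : C)) ?_
    (Eventually.of_forall fun k => ?_)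
  · rw [tendsto_subtype_rng]
    simpa using hlim.smul_const (x : E)
  · have hk : (⨅ z : L, funkDist C x z) < 1 / ((k : ℝ) + 1) := by
      have h' : (⨅ z : L, funkDist C x z) = 0 := h.symm
      rw [h']; positivity
    obtain ⟨z, hz⟩ := exists_lt_of_ciInf_lt hk
    have h1 := (funkDist_le_iff hC (by positivity)).1 hz.le
    by_contra hnot
    refine hlow (y := z) ?_ hnot z.2
    rw [ConeLE.smul_left_iff hC (Real.exp_pos _), Real.exp_neg, inv_inv]
    exact h1

end InfFunkDist

/-! ### Stochastic order and integrals of monotone functions -/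

section StochasticOrder

variable {E : Type*} [NormedAddCommGroup E] [NormedSpace ℝ E] [MeasurableSpace E] [BorelSpace E]
  {C : ConvexCone ℝ E} {μ ν : ProbabilityMeasure C}

/-- The stochastic order also compares the masses of closed upper sets. -/
theorem StochLE.measure_le_of_isClosed (hC : IsProperOpen C) (h : StochLE C μ ν) {F : Set C}
    (hF : IsClosed F) (hup : IsConeUpper C F) : (μ : Measure C) F ≤ (ν : Measure C) F := by
  -- The union of the translates exp(-1/(k+1)) y + C with y in F: open upper sets that contain F and
  -- decrease to it.
  set U : ℕ → Set C := fun k =>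
    ⋃ y ∈ F, {x : C | (x : E) - Real.exp (-(1 / ((k : ℝ) + 1))) • (y : E) ∈ (C : Set E)} with hU
  have hmemU : ∀ k x, x ∈ U k ↔
      ∃ y ∈ F, (x : E) - Real.exp (-(1 / ((k : ℝ) + 1))) • (y : E) ∈ (C : Set E) := by
    intro k x; simp [hU]
  have hopen : ∀ k, IsOpen (U k) := fun k =>
    isOpen_biUnion fun y _ => hC.isOpen.preimage (by fun_prop)
  have hupper : ∀ k, IsConeUpper C (U k) := by
    intro k x x' hx hxU
    obtain ⟨y, hy, hxy⟩ := (hmemU k x).1 hxU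
    refine (hmemU k x').2 ⟨y, hy, ?_⟩
    have := hC.add_closure_mem hxy hx
    rwa [sub_add_sub_comm, add_comm, add_sub_add_right_eq_sub] at this
  have hsub : ∀ k, F ⊆ U k := by
    intro k y hy
    refine (hmemU k y).2 ⟨y, hy, ?_⟩
    have hpos : 0 < 1 - Real.exp (-(1 / ((k : ℝ) + 1))) := by
      rw [sub_pos, Real.exp_lt_one_iff]
      simp only [Left.neg_neg_iff]; positivity
    have := C.smul_mem' hpos y.2
    rwa [sub_smul, one_smul] at this
  have hanti : Antitone U := by
    intro k l hkl x hx
    obtain ⟨y, hy, hxy⟩ := (hmemU l x).1 hx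
    refine (hmemU k x).2 ⟨y, hy, ?_⟩
    have hle : Real.exp (-(1 / ((k : ℝ) + 1))) ≤ Real.exp (-(1 / ((l : ℝ) + 1))) := by
      rw [Real.exp_le_exp, neg_le_neg_iff]
      exact one_div_le_one_div_of_le (by positivity) (by exact_mod_cast Nat.succ_le_succ hkl)
    have := hC.add_closure_mem hxy (ConeLE.smul_le_smul hC y.2 hle)
    rwa [sub_add_sub_cancel] at this
  have hlim : Tendsto (fun k : ℕ => Real.exp (1 / ((k : ℝ) + 1))) atTop (𝓝 1) := by
    have := (Real.continuous_exp.tendsto 0).comp tendsto_one_div_add_atTop_nhds_zero_nat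
    rwa [Real.exp_zero] at this
  have hinter : ⋂ k, U k = F := by
    refine Set.Subset.antisymm (fun x hx => ?_) (Set.subset_iInter hsub)
    -- Membership of x in the k-th set puts exp(1/(k+1)) x above a point of F, hence in F; letting k
    -- grow gives x in F.
    have hmem : ∀ k : ℕ,
        (⟨Real.exp (1 / ((k : ℝ) + 1)) • (x : E), C.smul_mem' (Real.exp_pos _) x.2⟩ : C) ∈ F := by
      intro k
      obtain ⟨y, hy, hxy⟩ := (hmemU k x).1 (Set.mem_iInter.1 hx k)
      refine hup ?_ hy
      have h1 : ConeLE C (Real.exp (-(1 / ((k : ℝ) + 1))) • (y : E)) x := subset_closure hxy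
      rwa [ConeLE.smul_left_iff hC (Real.exp_pos _), Real.exp_neg, inv_inv] at h1
    refine hF.mem_of_tendsto (b := atTop) (f := fun k : ℕ =>
      (⟨Real.exp (1 / ((k : ℝ) + 1)) • (x : E), C.smul_mem' (Real.exp_pos _) x.2⟩ : C)) ?_
      (Eventually.of_forall hmem)
    rw [tendsto_subtype_rng]
    simpa using hlim.smul_const (x : E)
  have ht := tendsto_measure_iInter_atTop (μ := (ν : Measure C)) (s := U)
    (fun k => (hopen k).measurableSet.nullMeasurableSet) hanti ⟨0, measure_ne_top _ _⟩
  rw [hinter] at ht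
  exact ge_of_tendsto' ht fun k => (measure_mono (hsub k)).trans (h _ (hopen k) (hupper k))

/-- Layer cake: the strict superlevel sets of a continuous monotone function are open upper sets. -/
theorem StochLE.lintegral_mono (h : StochLE C μ ν) {g : C → ℝ} (hg : Continuous g)
    (h0 : ∀ x, 0 ≤ g x) (hm : IsConeMonotone C g) :
    ∫⁻ x, ENNReal.ofReal (g x) ∂(μ : Measure C) ≤ ∫⁻ x, ENNReal.ofReal (g x) ∂(ν : Measure C) := by
  rw [lintegral_eq_lintegral_meas_lt _ (Eventually.of_forall h0) hg.measurable.aemeasurable,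
    lintegral_eq_lintegral_meas_lt _ (Eventually.of_forall h0) hg.measurable.aemeasurable]
  exact MeasureTheory.lintegral_mono fun t =>
    h _ (isOpen_lt continuous_const hg) fun x y hxy hx => lt_of_lt_of_le hx (hm hxy)

/-- The complement {g ≤ t} is a closed upper set, which is why the stochastic order is needed on
closed sets too. -/
theorem StochLE.measure_lt_anti (hC : IsProperOpen C) (h : StochLE C μ ν) {g : C → ℝ}
    (hg : Continuous g) (hm : ∀ ⦃x y : C⦄, ConeLE C (x : E) (y : E) → g y ≤ g x) (t : ℝ) :
    (ν : Measure C) {x | t < g x} ≤ (μ : Measure C) {x | t < g x} := by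
  have hcl : IsClosed {x | t < g x}ᶜ := (isOpen_lt continuous_const hg).isClosed_compl
  have key := h.measure_le_of_isClosed hC hcl fun x y hxy hx hy => hx (lt_of_lt_of_le hy (hm hxy))
  rw [← compl_compl {x | t < g x}, prob_compl_eq_one_sub hcl.measurableSet,
    prob_compl_eq_one_sub hcl.measurableSet]
  exact tsub_le_tsub_left key _

theorem StochLE.lintegral_anti (hC : IsProperOpen C) (h : StochLE C μ ν) {g : C → ℝ}
    (hg : Continuous g) (h0 : ∀ x, 0 ≤ g x)
    (hm : ∀ ⦃x y : C⦄, ConeLE C (x : E) (y : E) → g y ≤ g x) :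
    ∫⁻ x, ENNReal.ofReal (g x) ∂(ν : Measure C) ≤ ∫⁻ x, ENNReal.ofReal (g x) ∂(μ : Measure C) := by
  rw [lintegral_eq_lintegral_meas_lt _ (Eventually.of_forall h0) hg.measurable.aemeasurable,
    lintegral_eq_lintegral_meas_lt _ (Eventually.of_forall h0) hg.measurable.aemeasurable]
  exact MeasureTheory.lintegral_mono fun t => h.measure_lt_anti hC hg hm t

theorem StochLE.integral_mono (h : StochLE C μ ν) (f : C →ᵇ ℝ)
    (h0 : ∀ x, 0 ≤ f x) (hm : IsConeMonotone C f) :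
    ∫ x, f x ∂(μ : Measure C) ≤ ∫ x, f x ∂(ν : Measure C) := by
  have key := h.lintegral_mono f.continuous h0 hm
  rw [← ofReal_integral_eq_lintegral_ofReal (f.integrable _) (Eventually.of_forall h0),
    ← ofReal_integral_eq_lintegral_ofReal (f.integrable _) (Eventually.of_forall h0)] at key
  exact (ENNReal.ofReal_le_ofReal_iff (integral_nonneg h0)).1 key

/-- Bounded continuous monotone functions determine the stochastic order. -/
theorem stochLE_of_integral_le (hC : IsProperOpen C)
    (h : ∀ f : C →ᵇ ℝ, (∀ x, 0 ≤ f x) → IsConeMonotone C f →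
      ∫ x, f x ∂(μ : Measure C) ≤ ∫ x, f x ∂(ν : Measure C)) : StochLE C μ ν := by
  intro U hU hup
  -- If U is everything, both masses are 1; the distance to the empty set would be 0 and useless as
  -- an approximation.
  rcases (Uᶜ).eq_empty_or_nonempty with he | hne
  · simp [Set.compl_empty_iff.1 he]
  have hcont : Continuous (infFunkDist C Uᶜ) :=
    continuous_of_le_funkDist_add hC (infFunkDist_le_add hC _)
  have h0 : ∀ n : ℕ, ∀ x, 0 ≤ (n : ℝ) * infFunkDist C Uᶜ x := fun n x =>
    mul_nonneg n.cast_nonneg (infFunkDist_nonneg x)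
  -- These monotone functions converge to the indicator of U: the distance to the complement is
  -- positive exactly on U.
  let f : ℕ → (C →ᵇ ℝ) := fun n =>
    truncOne (fun x => (n : ℝ) * infFunkDist C Uᶜ x) (continuous_const.mul hcont) (h0 n)
  have hf : ∀ n x, f n x = min 1 ((n : ℝ) * infFunkDist C Uᶜ x) := fun n x => rfl
  have hpt : ∀ x, Tendsto (fun n => f n x) atTop (𝓝 (U.indicator 1 x)) := by
    intro x
    simp only [hf]
    by_cases hx : x ∈ U
    · have hpos : 0 < infFunkDist C Uᶜ x :=
        infFunkDist_pos hC hU.isClosed_compl hne (by rwa [compl_compl]) (by simpa using hx)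
      rw [Set.indicator_of_mem hx]
      refine tendsto_const_nhds.congr' ?_
      filter_upwards [(tendsto_natCast_atTop_atTop.atTop_mul_const hpos).eventually_ge_atTop 1]
        with n hn
      rw [min_eq_left hn, Pi.one_apply]
    · rw [Set.indicator_of_notMem hx]
      have hz : infFunkDist C Uᶜ x = 0 := by
        refine le_antisymm ?_ (infFunkDist_nonneg x)
        rw [← funkDist_self hC x]
        exact infFunkDist_le x hx
      simp [hz]
  have hlim : ∀ ρ : ProbabilityMeasure C,
      Tendsto (fun n => ∫ x, f n x ∂(ρ : Measure C)) atTop (𝓝 ((ρ : Measure C).real U)) := by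
    intro ρ
    rw [← integral_indicator_one hU.measurableSet]
    refine tendsto_integral_of_dominated_convergence (fun _ => 1)
      (fun n => (f n).continuous.aestronglyMeasurable) (integrable_const _)
      (fun n => Eventually.of_forall fun x => ?_) (Eventually.of_forall hpt)
    rw [hf, Real.norm_of_nonneg (le_min zero_le_one (h0 n x))]
    exact min_le_left _ _
  have hle : (μ : Measure C).real U ≤ (ν : Measure C).real U :=
    le_of_tendsto_of_tendsto' (hlim μ) (hlim ν) fun n =>
      h (f n) (fun x => le_min zero_le_one (h0 n x)) fun x y hxy => by
        rw [hf, hf]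
        exact min_le_min le_rfl
          (mul_le_mul_of_nonneg_left (infFunkDist_mono hC _ hxy) n.cast_nonneg)
  exact (ENNReal.toReal_le_toReal (measure_ne_top _ _) (measure_ne_top _ _)).1 hle

end StochasticOrder

theorem tendsto_measure_natCast_lt {X : Type*} [MeasurableSpace X] (μ : Measure X)
    [IsFiniteMeasure μ] {g : X → ℝ} (hg : Measurable g) :
    Tendsto (fun k : ℕ => μ {x | (k : ℝ) < g x}) atTop (𝓝 0) := by
  have h := tendsto_measure_iInter_atTop (μ := μ) (s := fun k : ℕ => {x | (k : ℝ) < g x})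
    (fun k => (measurableSet_lt measurable_const hg).nullMeasurableSet)
    (fun k l hkl x hx => lt_of_le_of_lt (by exact_mod_cast hkl : (k : ℝ) ≤ l) hx)
    ⟨0, measure_ne_top _ _⟩
  have he : ⋂ k : ℕ, {x | (k : ℝ) < g x} = ∅ := by
    ext x
    simp only [Set.mem_iInter, Set.mem_ofPred_eq, Set.mem_empty_iff_false, iff_false, not_forall,
      not_lt]
    exact exists_nat_ge _
  rwa [he, measure_empty] at h

/-! ### The algebra generated by monotone functions -/

section MonotoneAlgebra

variable {E : Type*} [NormedAddCommGroup E] [NormedSpace ℝ E] {C : ConvexCone ℝ E}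

/-- The multiplicative monoid of nonnegative bounded continuous monotone functions. -/
def monotoneSubmonoid (C : ConvexCone ℝ E) : Submonoid (C →ᵇ ℝ) where
  carrier := {f | (∀ x, 0 ≤ f x) ∧ IsConeMonotone C f}
  one_mem' := ⟨fun _ => zero_le_one, fun _ _ _ => le_rfl⟩
  mul_mem' := fun hf hg => ⟨fun x => mul_nonneg (hf.1 x) (hg.1 x),
    fun x y h => mul_le_mul (hf.2 h) (hg.2 h) (hg.1 x) (hf.1 y)⟩

/-- The algebra generated by the nonnegative bounded continuous monotone functions. -/
def monotoneAlgebra (C : ConvexCone ℝ E) : StarSubalgebra ℝ (C →ᵇ ℝ) where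
  __ := Algebra.adjoin ℝ (monotoneSubmonoid C : Set (C →ᵇ ℝ))
  star_mem' := fun {f} hf => by
    have : star f = f := by ext x; simp
    rwa [this]

/-- If x ≤ y fails, the truncated distance to y is monotone, vanishes at y and is positive at x.
Distinct points fail to be comparable in at least one direction, since the cone is salient. -/
theorem monotoneAlgebra_separatesPoints (hC : IsProperOpen C) :
    ((monotoneAlgebra C).map
      (BoundedContinuousFunction.toContinuousMapStarₐ ℝ)).SeparatesPoints := by
  have key : ∀ x y : C, ¬ ConeLE C (x : E) (y : E) →
      ∃ f : C →ᵇ ℝ, f ∈ monotoneAlgebra C ∧ f x ≠ f y := by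
    intro x y hxy
    refine ⟨truncOne (fun z => funkDist C z y) (continuous_funkDist_left hC y)
      fun z => funkDist_nonneg z y, Algebra.subset_adjoin
        ⟨fun z => le_min zero_le_one (funkDist_nonneg z y),
          fun z w h => min_le_min le_rfl (funkDist_mono_left hC h y)⟩, ?_⟩
    have h1 : 0 < funkDist C x y :=
      (funkDist_nonneg x y).lt_of_ne fun h => hxy ((funkDist_eq_zero_iff hC).1 h.symm)
    change min 1 (funkDist C x y) ≠ min 1 (funkDist C y y)
    rw [funkDist_self hC, min_eq_right zero_le_one]
    exact (lt_min one_pos h1).ne'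
  intro x y hxy
  have : ∃ f : C →ᵇ ℝ, f ∈ monotoneAlgebra C ∧ f x ≠ f y := by
    by_cases h1 : ConeLE C (x : E) (y : E)
    · by_cases h2 : ConeLE C (y : E) (x : E)
      · refine absurd (Subtype.ext ?_) hxy
        have := hC.eq_zero ((y : E) - x) h1 (by rw [neg_sub]; exact h2)
        exact (sub_eq_zero.1 this).symm
      · obtain ⟨f, hf, hne⟩ := key y x h2
        exact ⟨f, hf, hne.symm⟩
    · exact key x y h1
  obtain ⟨f, hf, hne⟩ := this
  exact ⟨f, ⟨f.toContinuousMap, ⟨f, hf, rfl⟩, rfl⟩, hne⟩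

end MonotoneAlgebra

/-! ### Bounds for monotone sequences of measures -/

section MonotoneSequences

variable {E : Type*} [NormedAddCommGroup E] [NormedSpace ℝ E] [MeasurableSpace E]
  {C : ConvexCone ℝ E}

theorem StochLE.of_le_succ {μs : ℕ → ProbabilityMeasure C}
    (hm : ∀ n, StochLE C (μs n) (μs (n + 1))) (n : ℕ) : StochLE C (μs 0) (μs n) :=
  fun _ hU hup => monotone_nat_of_le_succ (f := fun k => (μs k : Measure C) _)
    (fun k => hm k _ hU hup) n.zero_le

theorem StochLE.of_succ_le {μs : ℕ → ProbabilityMeasure C}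
    (hm : ∀ n, StochLE C (μs (n + 1)) (μs n)) (n : ℕ) : StochLE C (μs n) (μs 0) :=
  fun _ hU hup => antitone_nat_of_succ_le (f := fun k => (μs k : Measure C) _)
    (fun k => hm k _ hU hup) n.zero_le

end MonotoneSequences

/-! ### Tightness and weak convergence -/

section WeakConvergence

variable {E : Type*} [NormedAddCommGroup E] [NormedSpace ℝ E] [MeasurableSpace E] [BorelSpace E]
  {C : ConvexCone ℝ E}

/-- A stochastically bounded set of probability measures on the cone is tight. -/
theorem isTightMeasureSet_of_stochLE [FiniteDimensional ℝ E] (hC : IsProperOpen C)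
    (hne : Nonempty C) {ν₁ ν₂ : ProbabilityMeasure C} {μs : ℕ → ProbabilityMeasure C}
    (h₁ : ∀ n, StochLE C ν₁ (μs n)) (h₂ : ∀ n, StochLE C (μs n) ν₂) :
    IsTightMeasureSet {(μs n : Measure C) | n} := by
  obtain ⟨u⟩ := hne
  rw [isTightMeasureSet_iff_exists_isCompact_measure_compl_le]
  intro ε hε
  have hl := continuous_funkDist_left hC u
  have hr := continuous_funkDist_right hC u
  have ht := (tendsto_measure_natCast_lt (ν₂ : Measure C) hl.measurable).add
    (tendsto_measure_natCast_lt (ν₁ : Measure C) hr.measurable)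
  rw [add_zero] at ht
  obtain ⟨k, hk⟩ := (ht.eventually_lt_const hε).exists
  refine ⟨_, isCompact_funkDist_le hC u k.cast_nonneg, ?_⟩
  rintro _ ⟨n, rfl⟩
  -- Points escaping upwards form an open upper set, whose mass ν₂ bounds; points escaping downwards
  -- form a lower set, whose mass ν₁ bounds.
  have hsub : {z : C | funkDist C z u ≤ k ∧ funkDist C u z ≤ k}ᶜ ⊆
      {z | (k : ℝ) < funkDist C z u} ∪ {z | (k : ℝ) < funkDist C u z} := by
    intro z hz
    by_contra hz'
    simp only [Set.mem_union, Set.mem_ofPred_eq, not_or, not_lt] at hz'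
    exact hz hz'
  calc (μs n : Measure C) _ ≤ _ := measure_mono hsub
    _ ≤ _ := measure_union_le _ _
    _ ≤ _ := add_le_add
      (h₂ n _ (isOpen_lt continuous_const hl)
        fun x y hxy hx => lt_of_lt_of_le hx (funkDist_mono_left hC hxy u))
      ((h₁ n).measure_lt_anti hC hr (fun x y hxy => funkDist_anti_right hC hxy u) k)
    _ ≤ ε := hk.le

/-- Products of nonnegative monotone functions are again such functions, so the generated algebra is
only their linear span and convergence extends by linearity. -/
theorem tendsto_integral_of_mem_monotoneAlgebra {μ : ProbabilityMeasure C}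
    {μs : ℕ → ProbabilityMeasure C}
    (h : ∀ f : C →ᵇ ℝ, (∀ x, 0 ≤ f x) → IsConeMonotone C f →
      Tendsto (fun n => ∫ x, f x ∂(μs n : Measure C)) atTop (𝓝 (∫ x, f x ∂(μ : Measure C))))
    {g : C →ᵇ ℝ} (hg : g ∈ monotoneAlgebra C) :
    Tendsto (fun n => ∫ x, g x ∂(μs n : Measure C)) atTop (𝓝 (∫ x, g x ∂(μ : Measure C))) := by
  have hg' : g ∈ Submodule.span ℝ (monotoneSubmonoid C : Set (C →ᵇ ℝ)) := by
    have : g ∈ Subalgebra.toSubmodule (Algebra.adjoin ℝ (monotoneSubmonoid C : Set (C →ᵇ ℝ))) := hg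
    rwa [Algebra.adjoin_eq_span, Submonoid.closure_eq] at this
  clear hg
  induction hg' using Submodule.span_induction with
  | mem f hf => exact h f hf.1 hf.2
  | zero => simp
  | add f g _ _ hf hg =>
    have e : ∀ ρ : ProbabilityMeasure C, ∫ x, (f + g) x ∂(ρ : Measure C) =
        ∫ x, f x ∂(ρ : Measure C) + ∫ x, g x ∂(ρ : Measure C) := fun ρ =>
      integral_add (f.integrable _) (g.integrable _)
    simp only [e]
    exact hf.add hg
  | smul c f _ hf =>
    have e : ∀ ρ : ProbabilityMeasure C, ∫ x, (c • f) x ∂(ρ : Measure C) =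
        c * ∫ x, f x ∂(ρ : Measure C) := fun ρ => integral_const_mul c _
    simp only [e]
    exact hf.const_mul c

theorem tendsto_of_tendsto_integral_monotone [FiniteDimensional ℝ E] (hC : IsProperOpen C)
    (hne : Nonempty C) {μ ν₁ ν₂ : ProbabilityMeasure C} {μs : ℕ → ProbabilityMeasure C}
    (h₁ : ∀ n, StochLE C ν₁ (μs n)) (h₂ : ∀ n, StochLE C (μs n) ν₂)
    (h : ∀ f : C →ᵇ ℝ, (∀ x, 0 ≤ f x) → IsConeMonotone C f →
      Tendsto (fun n => ∫ x, f x ∂(μs n : Measure C)) atTop (𝓝 (∫ x, f x ∂(μ : Measure C)))) :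
    Tendsto μs atTop (𝓝 μ) := by
  have : CompleteSpace E := FiniteDimensional.complete ℝ E
  have : ProperSpace E := FiniteDimensional.proper ℝ E
  have : PolishSpace C := hC.isOpen.polishSpace
  exact ProbabilityMeasure.tendsto_of_tight_of_separatesPoints ℝ
    (isTightMeasureSet_of_stochLE hC hne h₁ h₂) (monotoneAlgebra_separatesPoints hC)
    fun g hg => tendsto_integral_of_mem_monotoneAlgebra h hg

theorem tendsto_integral_of_tendsto {μ : ProbabilityMeasure C} {μs : ℕ → ProbabilityMeasure C}
    (h : Tendsto μs atTop (𝓝 μ)) (f : C →ᵇ ℝ) :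
    Tendsto (fun n => ∫ x, f x ∂(μs n : Measure C)) atTop (𝓝 (∫ x, f x ∂(μ : Measure C))) :=
  ProbabilityMeasure.tendsto_iff_forall_integral_tendsto.1 h f

/-- A stochastically increasing sequence is below its weak limit. -/
theorem StochLE.le_of_tendsto_of_monotone (hC : IsProperOpen C) {μ : ProbabilityMeasure C}
    {μs : ℕ → ProbabilityMeasure C} (hm : ∀ n, StochLE C (μs n) (μs (n + 1)))
    (h : Tendsto μs atTop (𝓝 μ)) (n : ℕ) : StochLE C (μs n) μ :=
  stochLE_of_integral_le hC fun f h0 hf =>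
    (monotone_nat_of_le_succ fun k => (hm k).integral_mono f h0 hf).ge_of_tendsto
      (tendsto_integral_of_tendsto h f) n

/-- A stochastically decreasing sequence is above its weak limit. -/
theorem StochLE.ge_of_tendsto_of_antitone (hC : IsProperOpen C) {μ : ProbabilityMeasure C}
    {μs : ℕ → ProbabilityMeasure C} (hm : ∀ n, StochLE C (μs (n + 1)) (μs n))
    (h : Tendsto μs atTop (𝓝 μ)) (n : ℕ) : StochLE C μ (μs n) :=
  stochLE_of_integral_le hC fun f h0 hf =>
    (antitone_nat_of_succ_le fun k => (hm k).integral_mono f h0 hf).le_of_tendsto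
      (tendsto_integral_of_tendsto h f) n

/-- In the converse direction, convergence of increasing integrals already places every term between
the first measure and μ, which supplies the tightness needed for weak convergence. -/
theorem monotone_tendsto_iff [FiniteDimensional ℝ E] (hC : IsProperOpen C) (hne : Nonempty C)
    (μ : ProbabilityMeasure C) (μs : ℕ → ProbabilityMeasure C) :
    ((∀ n, StochLE C (μs n) (μs (n + 1))) ∧ Tendsto μs atTop (𝓝 μ)) ↔
      ∀ f : C →ᵇ ℝ, (∀ x, 0 ≤ f x) → IsConeMonotone C f →
        Monotone (fun n => ∫ x, f x ∂(μs n : Measure C)) ∧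
        Tendsto (fun n => ∫ x, f x ∂(μs n : Measure C)) atTop
          (𝓝 (∫ x, f x ∂(μ : Measure C))) := by
  constructor
  · rintro ⟨hm, h⟩ f h0 hf
    exact ⟨monotone_nat_of_le_succ fun k => (hm k).integral_mono f h0 hf,
      tendsto_integral_of_tendsto h f⟩
  · intro h
    have hm : ∀ n, StochLE C (μs n) (μs (n + 1)) := fun n =>
      stochLE_of_integral_le hC fun f h0 hf => (h f h0 hf).1 n.le_succ
    have hle : ∀ n, StochLE C (μs n) μ := fun n =>
      stochLE_of_integral_le hC fun f h0 hf => (h f h0 hf).1.ge_of_tendsto (h f h0 hf).2 n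
    exact ⟨hm, tendsto_of_tendsto_integral_monotone hC hne (StochLE.of_le_succ hm) hle
      fun f h0 hf => (h f h0 hf).2⟩

theorem antitone_tendsto_iff [FiniteDimensional ℝ E] (hC : IsProperOpen C) (hne : Nonempty C)
    (μ : ProbabilityMeasure C) (μs : ℕ → ProbabilityMeasure C) :
    ((∀ n, StochLE C (μs (n + 1)) (μs n)) ∧ Tendsto μs atTop (𝓝 μ)) ↔
      ∀ f : C →ᵇ ℝ, (∀ x, 0 ≤ f x) → IsConeMonotone C f →
        Antitone (fun n => ∫ x, f x ∂(μs n : Measure C)) ∧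
        Tendsto (fun n => ∫ x, f x ∂(μs n : Measure C)) atTop
          (𝓝 (∫ x, f x ∂(μ : Measure C))) := by
  constructor
  · rintro ⟨hm, h⟩ f h0 hf
    exact ⟨antitone_nat_of_succ_le fun k => (hm k).integral_mono f h0 hf,
      tendsto_integral_of_tendsto h f⟩
  · intro h
    have hm : ∀ n, StochLE C (μs (n + 1)) (μs n) := fun n =>
      stochLE_of_integral_le hC fun f h0 hf => (h f h0 hf).1 n.le_succ
    have hle : ∀ n, StochLE C μ (μs n) := fun n =>
      stochLE_of_integral_le hC fun f h0 hf => (h f h0 hf).1.le_of_tendsto (h f h0 hf).2 n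
    exact ⟨hm, tendsto_of_tendsto_integral_monotone hC hne hle (StochLE.of_succ_le hm)
      fun f h0 hf => (h f h0 hf).2⟩

end WeakConvergence

/-! ### Explicit couplings -/

section Coupling

variable {X : Type*} [MeasurableSpace X]

/-- A doubly normalised density with respect to the product measure defines a coupling. -/
theorem exists_coupling_of_density (μ ν : ProbabilityMeasure X) {H : X × X → ℝ≥0∞}
    (hH : Measurable H) (h₁ : ∀ x, ∫⁻ y, H (x, y) ∂(ν : Measure X) = 1)
    (h₂ : ∀ y, ∫⁻ x, H (x, y) ∂(μ : Measure X) = 1) :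
    ∃ π : ProbabilityMeasure (X × X), (π : Measure (X × X)).map Prod.fst = μ ∧
      (π : Measure (X × X)).map Prod.snd = ν ∧
      (π : Measure (X × X)) = ((μ : Measure X).prod (ν : Measure X)).withDensity H := by
  set ρ := ((μ : Measure X).prod (ν : Measure X)).withDensity H with hρ
  have hfst : ρ.map Prod.fst = μ := by
    ext s hs
    rw [Measure.map_apply measurable_fst hs, hρ, withDensity_apply _ (measurable_fst hs),
      ← lintegral_indicator (measurable_fst hs),
      lintegral_prod _ (hH.indicator (measurable_fst hs)).aemeasurable]
    have : ∀ x, ∫⁻ y, (Prod.fst ⁻¹' s).indicator H (x, y) ∂(ν : Measure X) =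
        s.indicator 1 x := by
      intro x
      by_cases hx : x ∈ s
      · simp only [Set.indicator, Set.mem_preimage, hx, if_true, h₁, Pi.one_apply]
      · simp [Set.indicator, hx]
    simp_rw [this]
    exact lintegral_indicator_one hs
  have hsnd : ρ.map Prod.snd = ν := by
    ext s hs
    rw [Measure.map_apply measurable_snd hs, hρ, withDensity_apply _ (measurable_snd hs),
      ← lintegral_indicator (measurable_snd hs),
      lintegral_prod_symm _ (hH.indicator (measurable_snd hs)).aemeasurable]
    have : ∀ y, ∫⁻ x, (Prod.snd ⁻¹' s).indicator H (x, y) ∂(μ : Measure X) =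
        s.indicator 1 y := by
      intro y
      by_cases hy : y ∈ s
      · simp only [Set.indicator, Set.mem_preimage, hy, if_true, h₂, Pi.one_apply]
      · simp [Set.indicator, hy]
    simp_rw [this]
    exact lintegral_indicator_one hs
  have hprob : IsProbabilityMeasure ρ := by
    refine ⟨?_⟩
    have := congrArg (fun m : Measure X => m Set.univ) hfst
    simpa [Measure.map_apply measurable_fst MeasurableSet.univ] using this
  exact ⟨⟨ρ, hprob⟩, hfst, hsnd, rfl⟩

/-- Two measures giving similar masses to the members of a fine subpartition of unity
have a coupling of small cost. -/
theorem exists_coupling_lintegral_le {ι : Type*} (s : Finset ι) (μ ν : ProbabilityMeasure X)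
    {φ : ι → X → ℝ≥0∞} (hφ : ∀ i, Measurable (φ i)) (hsum : ∀ x, ∑ i ∈ s, φ i x ≤ 1)
    {w : ι → ℝ≥0∞} {θ : ℝ≥0∞} (hθ : θ < 1)
    (hwμ : ∀ i ∈ s, w i * ∫⁻ x, φ i x ∂(μ : Measure X) ≤ 1)
    (hwν : ∀ i ∈ s, w i * ∫⁻ x, φ i x ∂(ν : Measure X) ≤ θ)
    {c : X × X → ℝ≥0∞} (hc : Measurable c) {κ : ℝ≥0∞}
    (hcκ : ∀ i ∈ s, ∀ x y, φ i x ≠ 0 → φ i y ≠ 0 → c (x, y) ≤ κ)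
    {A T : X → ℝ≥0∞} {S : ℝ≥0∞} (hA : Measurable A) (hT : Measurable T)
    (hcA : ∀ x y, c (x, y) ≤ A x + A y) (hAT : ∀ x, A x ≤ S + T x) :
    ∃ π : ProbabilityMeasure (X × X), (π : Measure (X × X)).map Prod.fst = μ ∧
      (π : Measure (X × X)).map Prod.snd = ν ∧
      ∫⁻ z, c z ∂(π : Measure (X × X)) ≤ κ + ((S * (1 - ∑ i ∈ s,
          w i * (∫⁻ x, φ i x ∂(μ : Measure X)) * ∫⁻ x, φ i x ∂(ν : Measure X)) +
            ∫⁻ x, T x ∂(μ : Measure X)) + (S * (1 - ∑ i ∈ s,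
          w i * (∫⁻ x, φ i x ∂(μ : Measure X)) * ∫⁻ x, φ i x ∂(ν : Measure X)) +
            ∫⁻ x, T x ∂(ν : Measure X))) := by
  set a : ι → ℝ≥0∞ := fun i => ∫⁻ x, φ i x ∂(μ : Measure X) with ha
  set b : ι → ℝ≥0∞ := fun i => ∫⁻ x, φ i x ∂(ν : Measure X) with hb
  set m : ℝ≥0∞ := ∑ i ∈ s, w i * a i * b i with hm
  have hsum_a : ∑ i ∈ s, a i ≤ 1 := by
    rw [ha, ← lintegral_finsetSum s fun i _ => hφ i]
    exact (lintegral_mono hsum).trans (by simp)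
  -- The total mass m of the part of the coupling near the diagonal stays below 1, so dividing by 1
  -- - m is legitimate.
  have hmθ : m ≤ θ := by
    calc m ≤ ∑ i ∈ s, θ * a i := Finset.sum_le_sum fun i hi => by
          rw [mul_right_comm]; exact mul_le_mul_left (hwν i hi) _
      _ = θ * ∑ i ∈ s, a i := (Finset.mul_sum _ _ _).symm
      _ ≤ θ * 1 := mul_le_mul_right hsum_a _
      _ = θ := mul_one θ
  have hm1 : m < 1 := hmθ.trans_lt hθ
  have hδ0 : (1 - m) ≠ 0 := (tsub_pos_of_lt hm1).ne'
  have hδt : (1 - m) ≠ ∞ := ENNReal.sub_ne_top ENNReal.one_ne_top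
  -- J is a density concentrated near the diagonal, with marginal densities P and Q, both at most 1.
  -- The missing marginals 1 - P and 1 - Q, each of mass 1 - m, are coupled independently by the
  -- density (1 - P)(1 - Q)/(1 - m).
  set P : X → ℝ≥0∞ := fun x => ∑ i ∈ s, w i * b i * φ i x with hP
  set Q : X → ℝ≥0∞ := fun x => ∑ i ∈ s, w i * a i * φ i x with hQ
  set J : X × X → ℝ≥0∞ := fun z => ∑ i ∈ s, w i * φ i z.1 * φ i z.2 with hJ
  have hPm : Measurable P := Finset.measurable_fun_sum _ fun i _ => (hφ i).const_mul _
  have hQm : Measurable Q := Finset.measurable_fun_sum _ fun i _ => (hφ i).const_mul _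
  have hJm : Measurable J := Finset.measurable_fun_sum _ fun i _ =>
    (((hφ i).comp measurable_fst).const_mul _).mul ((hφ i).comp measurable_snd)
  have hP1 : ∀ x, P x ≤ 1 := fun x => (Finset.sum_le_sum fun i hi =>
    (mul_le_mul_left ((hwν i hi).trans hθ.le) (φ i x)).trans (one_mul _).le).trans (hsum x)
  have hQ1 : ∀ x, Q x ≤ 1 := fun x => (Finset.sum_le_sum fun i hi =>
    (mul_le_mul_left (hwμ i hi) (φ i x)).trans (one_mul _).le).trans (hsum x)
  have hPint : ∫⁻ x, P x ∂(μ : Measure X) = m := by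
    rw [hP, lintegral_finsetSum s fun i _ => (hφ i).const_mul _]
    refine Finset.sum_congr rfl fun i _ => ?_
    rw [lintegral_const_mul _ (hφ i), mul_right_comm]
  have hQint : ∫⁻ x, Q x ∂(ν : Measure X) = m := by
    rw [hQ, lintegral_finsetSum s fun i _ => (hφ i).const_mul _]
    exact Finset.sum_congr rfl fun i _ => lintegral_const_mul _ (hφ i)
  have hJν : ∀ x, ∫⁻ y, J (x, y) ∂(ν : Measure X) = P x := by
    intro x
    simp only [hJ]
    rw [lintegral_finsetSum s fun i _ => (hφ i).const_mul _]
    refine Finset.sum_congr rfl fun i _ => ?_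
    rw [lintegral_const_mul _ (hφ i), mul_right_comm]
  have hJμ : ∀ y, ∫⁻ x, J (x, y) ∂(μ : Measure X) = Q y := by
    intro y
    simp only [hJ]
    rw [lintegral_finsetSum s fun i _ => ((hφ i).const_mul _).mul_const _]
    refine Finset.sum_congr rfl fun i _ => ?_
    rw [lintegral_mul_const _ ((hφ i).const_mul _), lintegral_const_mul _ (hφ i)]
  have hαint : ∫⁻ x, (1 - P x) ∂(μ : Measure X) = 1 - m := by
    rw [lintegral_sub hPm (by rw [hPint]; exact (hm1.trans ENNReal.one_lt_top).ne)
      (Eventually.of_forall hP1), hPint]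
    simp
  have hβint : ∫⁻ x, (1 - Q x) ∂(ν : Measure X) = 1 - m := by
    rw [lintegral_sub hQm (by rw [hQint]; exact (hm1.trans ENNReal.one_lt_top).ne)
      (Eventually.of_forall hQ1), hQint]
    simp
  have hαm : Measurable fun x => 1 - P x := measurable_const.sub hPm
  have hβm : Measurable fun x => 1 - Q x := measurable_const.sub hQm
  have hRm : Measurable fun z : X × X => (1 - P z.1) * (1 - Q z.2) * (1 - m)⁻¹ :=
    ((hαm.comp measurable_fst).mul (hβm.comp measurable_snd)).mul_const _
  have hHm : Measurable fun z : X × X => J z + (1 - P z.1) * (1 - Q z.2) * (1 - m)⁻¹ :=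
    hJm.add hRm
  obtain ⟨π, hπ₁, hπ₂, hπ⟩ := exists_coupling_of_density μ ν hHm
    (fun x => by
      change ∫⁻ y, (J (x, y) + (1 - P x) * (1 - Q y) * (1 - m)⁻¹) ∂(ν : Measure X) = 1
      rw [lintegral_add_right _ ((hβm.const_mul _).mul_const _), hJν,
        lintegral_mul_const _ (hβm.const_mul _), lintegral_const_mul _ hβm, hβint, mul_assoc,
        ENNReal.mul_inv_cancel hδ0 hδt, mul_one, add_tsub_cancel_of_le (hP1 x)])
    (fun y => by
      change ∫⁻ x, (J (x, y) + (1 - P x) * (1 - Q y) * (1 - m)⁻¹) ∂(μ : Measure X) = 1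
      rw [lintegral_add_right _ ((hαm.mul_const _).mul_const _), hJμ,
        lintegral_mul_const _ (hαm.mul_const _), lintegral_mul_const _ hαm, hαint,
        mul_right_comm, ENNReal.mul_inv_cancel hδ0 hδt, one_mul, add_tsub_cancel_of_le (hQ1 y)])
  refine ⟨π, hπ₁, hπ₂, ?_⟩
  have hJcost : ∀ z, J z * c z ≤ κ * J z := by
    intro z
    rw [hJ, Finset.sum_mul, Finset.mul_sum]
    refine Finset.sum_le_sum fun i hi => ?_
    rw [mul_comm κ]
    by_cases h1 : φ i z.1 = 0
    · simp [h1]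
    by_cases h2 : φ i z.2 = 0
    · simp [h2]
    exact mul_le_mul_right (hcκ i hi z.1 z.2 h1 h2) _
  -- Near the diagonal the cost is at most κ; on the product part it is split as A x + A y, so that
  -- each term integrates to a one-variable integral.
  have hpt : ∀ z : X × X, (J z + (1 - P z.1) * (1 - Q z.2) * (1 - m)⁻¹) * c z ≤
      κ * J z + ((A z.1 * (1 - P z.1)) * ((1 - Q z.2) * (1 - m)⁻¹) +
        ((1 - P z.1) * (1 - m)⁻¹) * (A z.2 * (1 - Q z.2))) := by
    intro z
    rw [add_mul]
    refine add_le_add (hJcost z) ((mul_le_mul_right (hcA z.1 z.2) _).trans_eq ?_)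
    ring
  have hJint : ∫⁻ z, J z ∂((μ : Measure X).prod (ν : Measure X)) ≤ 1 := by
    rw [lintegral_prod _ hJm.aemeasurable]
    simp_rw [hJν]
    rw [hPint]
    exact hm1.le
  -- The bounded part S of A sees only the small mass 1 - m; for the tail T the factor 1 - P is
  -- bounded by 1.
  have hAα : ∫⁻ x, A x * (1 - P x) ∂(μ : Measure X) ≤ S * (1 - m) + ∫⁻ x, T x ∂(μ : Measure X) := by
    calc _ ≤ ∫⁻ x, (S * (1 - P x) + T x) ∂(μ : Measure X) := lintegral_mono fun x => by
          refine (mul_le_mul_left (hAT x) _).trans ?_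
          rw [add_mul]
          exact add_le_add le_rfl ((mul_le_mul_right tsub_le_self _).trans (mul_one _).le)
      _ = _ := by rw [lintegral_add_right _ hT, lintegral_const_mul _ hαm, hαint]
  have hAβ : ∫⁻ x, A x * (1 - Q x) ∂(ν : Measure X) ≤ S * (1 - m) + ∫⁻ x, T x ∂(ν : Measure X) := by
    calc _ ≤ ∫⁻ x, (S * (1 - Q x) + T x) ∂(ν : Measure X) := lintegral_mono fun x => by
          refine (mul_le_mul_left (hAT x) _).trans ?_
          rw [add_mul]
          exact add_le_add le_rfl ((mul_le_mul_right tsub_le_self _).trans (mul_one _).le)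
      _ = _ := by rw [lintegral_add_right _ hT, lintegral_const_mul _ hβm, hβint]
  rw [hπ, lintegral_withDensity_eq_lintegral_mul _ hHm hc]
  refine (lintegral_mono hpt).trans ?_
  have hLm : Measurable fun z : X × X => (A z.1 * (1 - P z.1)) * ((1 - Q z.2) * (1 - m)⁻¹) :=
    ((hA.comp measurable_fst).mul (hαm.comp measurable_fst)).mul
      ((hβm.comp measurable_snd).mul_const _)
  rw [lintegral_add_left (hJm.const_mul _), lintegral_const_mul _ hJm, lintegral_add_left hLm,
    lintegral_prod_mul (f := fun x => A x * (1 - P x)) (hA.mul hαm).aemeasurable (hβm.mul_const _).aemeasurable,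
    lintegral_prod_mul (g := fun x => A x * (1 - Q x)) (hαm.mul_const _).aemeasurable
      (hA.mul hβm).aemeasurable,
    lintegral_mul_const _ hβm, lintegral_mul_const _ hαm, hαint, hβint,
    ENNReal.mul_inv_cancel hδ0 hδt, mul_one, one_mul]
  exact add_le_add ((mul_le_mul_right hJint _).trans (mul_one _).le) (add_le_add hAα hAβ)

end Coupling

/-! ### Subpartitions of unity with small supports -/

section Partition

open scoped NNReal

/-- A compact set has a subpartition of unity by functions with small supports. -/
theorem exists_subpartition {X : Type*} [TopologicalSpace X] {d : X → X → ℝ}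
    (h0 : ∀ x, d x x = 0) (hcomm : ∀ x y, d x y = d y x)
    (htri : ∀ x y z, d x z ≤ d x y + d y z) (hcont : Continuous fun z : X × X => d z.1 z.2)
    {K : Set X} (hK : IsCompact K) {r : ℝ} (hr : 0 < r) :
    ∃ (s : Finset X) (φ : X → X →ᵇ ℝ≥0), (∀ x, ∑ i ∈ s, φ i x ≤ 1) ∧
      (∀ x ∈ K, ∑ i ∈ s, φ i x = 1) ∧
      ∀ i x y, φ i x ≠ 0 → φ i y ≠ 0 → d x y ≤ 2 * r := by
  have hci : ∀ i, Continuous fun x => d x i := fun i =>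
    hcont.comp (continuous_id.prodMk continuous_const)
  obtain ⟨s, -, hs⟩ := hK.elim_nhds_subcover (fun i => {x | d x i < r / 2}) fun i _ =>
    (isOpen_lt (hci i) continuous_const).mem_nhds (by simpa [h0] using hr)
  set g : X → X → ℝ≥0 := fun i x => (r - d x i).toNNReal with hg
  have hgc : ∀ i, Continuous (g i) := fun i =>
    continuous_real_toNNReal.comp (continuous_const.sub (hci i))
  -- The floor r/2 keeps the denominator positive everywhere. On K some g i is at least r/2, so the
  -- floor is inactive and the quotients sum to exactly 1.
  set D : X → ℝ≥0 := fun x => max (∑ i ∈ s, g i x) (r / 2).toNNReal with hD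
  have hDc : Continuous D := (continuous_finsetSum s fun i _ => hgc i).max continuous_const
  have hDpos : ∀ x, D x ≠ 0 := fun x =>
    ((Real.toNNReal_pos.2 (half_pos hr)).trans_le (le_max_right _ _)).ne'
  set G : X → X → ℝ≥0 := fun i x => g i x / D x with hG
  have hGsum : ∀ x, ∑ i ∈ s, G i x = (∑ i ∈ s, g i x) / D x := fun x =>
    (Finset.sum_div _ _ _).symm
  have hGle : ∀ x, ∑ i ∈ s, G i x ≤ 1 := fun x => by
    rw [hGsum]; exact div_le_one_of_le₀ (le_max_left _ _) zero_le
  have hGc : ∀ i, Continuous (G i) := fun i => (hgc i).div₀ hDc hDpos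
  have hgr : ∀ i x, g i x ≤ r.toNNReal := fun i x => by
    refine Real.toNNReal_le_toNNReal ?_
    linarith [htri x i x, h0 x, hcomm x i]
  have hG2 : ∀ i x, G i x ≤ 2 := fun i x => by
    rw [hG]
    refine div_le_of_le_mul₀ zero_le zero_le ((hgr i x).trans ?_)
    refine le_trans (le_of_eq ?_) (mul_le_mul_right (le_max_right _ _) 2)
    rw [← NNReal.coe_inj]
    rw [NNReal.coe_mul, Real.coe_toNNReal _ hr.le, Real.coe_toNNReal _ (half_pos hr).le]
    push_cast
    ring
  refine ⟨s, fun i => BoundedContinuousFunction.mkOfBound ⟨G i, hGc i⟩ 2 fun x y => ?_, hGle,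
    fun x hx => ?_, fun i x y hx hy => ?_⟩
  · have h1 : (G i x : ℝ) ≤ 2 := by exact_mod_cast hG2 i x
    have h2 : (G i y : ℝ) ≤ 2 := by exact_mod_cast hG2 i y
    change dist (G i x) (G i y) ≤ 2
    rw [NNReal.dist_eq, abs_le]
    constructor <;> linarith [(G i x).coe_nonneg, (G i y).coe_nonneg]
  · change ∑ i ∈ s, G i x = 1
    rw [hGsum]
    obtain ⟨i, hi, hxi⟩ := Set.mem_iUnion₂.1 (hs hx)
    have hxi : d x i < r / 2 := hxi
    have h1 : (r / 2).toNNReal ≤ ∑ i ∈ s, g i x :=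
      le_trans (Real.toNNReal_le_toNNReal (by linarith))
        (Finset.single_le_sum (f := fun i => g i x) (fun _ _ => zero_le) hi)
    have h2 : D x = ∑ i ∈ s, g i x := max_eq_left h1
    rw [h2]
    exact div_self (h2 ▸ hDpos x)
  · have key : ∀ z, G i z ≠ 0 → d z i < r := by
      intro z hz
      by_contra! hle
      refine hz ?_
      have : g i z = 0 := Real.toNNReal_of_nonpos (by linarith)
      simp [hG, this]
    linarith [key x hx, key y hy, htri x i y, hcomm i y]

end Partition

/-! ### From weak convergence to couplings of small cost -/

section WassersteinOfWeak

open scoped NNReal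

variable {X : Type*} [MeasurableSpace X] [TopologicalSpace X] [PolishSpace X] [BorelSpace X]

/-- The square appears because t is used twice below: as a lower bound for the mass of a compact set
and as the proportion of mass coupled near the diagonal. -/
theorem exists_lt_one_mul_one_sub_lt {S ε : ℝ≥0∞} (hS : S ≠ ∞) (hε : 0 < ε) :
    ∃ t : ℝ≥0∞, 0 < t ∧ t < 1 ∧ S * (1 - t * t) < ε := by
  have h1 : Tendsto (fun t : ℝ≥0∞ => t * t) (𝓝 1) (𝓝 (1 * 1)) :=
    ENNReal.Tendsto.mul tendsto_id (Or.inl one_ne_zero) tendsto_id (Or.inl one_ne_zero)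
  have h2 : Tendsto (fun t : ℝ≥0∞ => S * (1 - t * t)) (𝓝 1) (𝓝 (S * (1 - 1 * 1))) :=
    ENNReal.Tendsto.const_mul
      (ENNReal.Tendsto.sub tendsto_const_nhds h1 (Or.inl ENNReal.one_ne_top)) (Or.inr hS)
  rw [mul_one, tsub_self, mul_zero] at h2
  have h3 : (𝓝[<] (1 : ℝ≥0∞)).NeBot := nhdsLT_neBot_of_exists_lt ⟨0, zero_lt_one⟩
  obtain ⟨t, ⟨ht, ht0⟩, ht1⟩ := ((eventually_nhdsWithin_of_eventually_nhds
    ((h2.eventually_lt_const hε).and (lt_mem_nhds zero_lt_one))).and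
      (self_mem_nhdsWithin (a := (1 : ℝ≥0∞)) (s := Set.Iio 1))).exists
  exact ⟨t, ht0, ht1, ht⟩

/-- Weak convergence together with uniformly small tails yields couplings of small cost. -/
theorem eventually_exists_coupling {d : X → X → ℝ} (h0 : ∀ x, d x x = 0)
    (hcomm : ∀ x y, d x y = d y x) (htri : ∀ x y z, d x z ≤ d x y + d y z)
    (hcont : Continuous fun z : X × X => d z.1 z.2) {p : ℝ} (hp : 0 < p)
    {μ : ProbabilityMeasure X} {μs : ℕ → ProbabilityMeasure X} (hμ : Tendsto μs atTop (𝓝 μ))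
    {ε : ℝ≥0∞} (hε : 0 < ε) {A T : X → ℝ≥0∞} {S : ℝ≥0∞} (hA : Measurable A) (hT : Measurable T)
    (hS : S ≠ ∞) (hcA : ∀ x y, ENNReal.ofReal (d x y) ^ p ≤ A x + A y)
    (hAT : ∀ x, A x ≤ S + T x) (hTμ : ∫⁻ x, T x ∂(μ : Measure X) ≤ ε)
    (hTμs : ∀ n, ∫⁻ x, T x ∂(μs n : Measure X) ≤ ε) :
    ∀ᶠ n in atTop, ∃ π : ProbabilityMeasure (X × X),
      (π : Measure (X × X)).map Prod.fst = μs n ∧ (π : Measure (X × X)).map Prod.snd = μ ∧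
      ∫⁻ z, ENNReal.ofReal (d z.1 z.2) ^ p ∂(π : Measure (X × X)) ≤
        ε + ((ε + ε) + (ε + ε)) := by
  obtain ⟨r, hr, hrpos⟩ : ∃ r : ℝ, ENNReal.ofReal (2 * r) ^ p < ε ∧ 0 < r := by
    have h1 : Continuous fun r : ℝ => ENNReal.ofReal (2 * r) ^ p :=
      ENNReal.continuous_rpow_const.comp (ENNReal.continuous_ofReal.comp (by fun_prop))
    have h2 := h1.tendsto 0
    simp only [mul_zero, ENNReal.ofReal_zero, ENNReal.zero_rpow_of_pos hp] at h2
    exact ((eventually_nhdsWithin_of_eventually_nhds (h2.eventually_lt_const hε)).and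
      (self_mem_nhdsWithin (a := (0 : ℝ)) (s := Set.Ioi 0))).exists
  obtain ⟨t, ht0, ht1, ht⟩ := exists_lt_one_mul_one_sub_lt hS hε
  obtain ⟨K, hK, hKμ⟩ := isTightMeasureSet_iff_exists_isCompact_measure_compl_le.1
    (isTightMeasureSet_singleton (μ := (μ : Measure X))) (1 - t) (tsub_pos_of_lt ht1)
  have hKt : t ≤ (μ : Measure X) K := by
    have h1 := hKμ _ rfl
    rw [prob_compl_eq_one_sub hK.measurableSet] at h1
    exact (ENNReal.sub_le_sub_iff_left ht1.le ENNReal.one_ne_top).1 h1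
  obtain ⟨s, φ, hφ1, hφK, hφd⟩ := exists_subpartition h0 hcomm htri hcont hK hrpos
  set b : X → ℝ≥0∞ := fun i => ∫⁻ x, φ i x ∂(μ : Measure X) with hb
  have hb1 : ∀ i ∈ s, b i ≤ 1 := fun i hi => by
    refine (lintegral_mono (g := fun _ => 1) fun x => ?_).trans (by simp)
    change (φ i x : ℝ≥0∞) ≤ 1
    exact_mod_cast (Finset.single_le_sum (f := fun i => φ i x) (fun _ _ => zero_le) hi).trans
      (hφ1 x)
  set a : ℕ → X → ℝ≥0∞ := fun n i => ∫⁻ x, φ i x ∂(μs n : Measure X) with ha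
  have hab : ∀ i, Tendsto (fun n => a n i) atTop (𝓝 (b i)) := fun i =>
    ProbabilityMeasure.tendsto_iff_forall_lintegral_tendsto.1 hμ (φ i)
  have hφm : ∀ i, Measurable fun x => (φ i x : ℝ≥0∞) := fun i =>
    (φ i).continuous.measurable.coe_nnreal_ennreal
  have hbsum : t ≤ ∑ i ∈ s, b i := by
    rw [hb, ← lintegral_finsetSum s fun i _ => hφm i]
    refine hKt.trans ?_
    rw [← lintegral_indicator_one hK.measurableSet]
    refine lintegral_mono fun x => ?_
    by_cases hx : x ∈ K
    · rw [Set.indicator_of_mem hx, Pi.one_apply]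
      have := congrArg ((↑) : ℝ≥0 → ℝ≥0∞) (hφK x hx)
      push_cast at this
      exact this.ge
    · rw [Set.indicator_of_notMem hx]
      exact zero_le
  -- With weight 1/b i the limiting coupling would use all of the mass on each cell; the factor t <
  -- 1 leaves room for w i * a n i < 1 once n is large. The near-diagonal mass then tends to t ∑ b i
  -- ≥ t². Null cells get weight 0.
  set w : X → ℝ≥0∞ := fun i => if b i = 0 then 0 else t / b i with hw
  have hwt : ∀ i, w i ≠ ∞ := fun i => by
    simp only [hw]
    split_ifs with h
    · simp
    · exact ENNReal.div_ne_top (ht1.trans ENNReal.one_lt_top).ne h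
  have hwb : ∀ i ∈ s, w i * b i ≤ t := fun i hi => by
    simp only [hw]
    split_ifs with h
    · simp
    · exact ENNReal.div_mul_cancel h ((hb1 i hi).trans_lt ENNReal.one_lt_top).ne |>.le
  have hwbb : ∀ i ∈ s, w i * b i * b i = t * b i := fun i hi => by
    by_cases h : b i = 0
    · simp [h]
    · simp only [hw, if_neg h]
      rw [ENNReal.div_mul_cancel h ((hb1 i hi).trans_lt ENNReal.one_lt_top).ne]
  have hwa : ∀ i, Tendsto (fun n => w i * a n i) atTop (𝓝 (w i * b i)) := fun i =>
    ENNReal.Tendsto.const_mul (hab i) (Or.inr (hwt i))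
  have hev1 : ∀ᶠ n in atTop, ∀ i ∈ s, w i * a n i < 1 :=
    (Filter.eventually_all_finset s).2 fun i hi =>
      (hwa i).eventually_lt_const ((hwb i hi).trans_lt ht1)
  have hsumlim : Tendsto (fun n => S * (1 - ∑ i ∈ s, w i * a n i * b i)) atTop
      (𝓝 (S * (1 - ∑ i ∈ s, w i * b i * b i))) := by
    refine ENNReal.Tendsto.const_mul (ENNReal.Tendsto.sub tendsto_const_nhds
      (tendsto_finsetSum s fun i hi => ?_) (Or.inl ENNReal.one_ne_top)) (Or.inr hS)
    exact ENNReal.Tendsto.mul_const (hwa i)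
      (Or.inr ((hb1 i hi).trans_lt ENNReal.one_lt_top).ne)
  have hlim : S * (1 - ∑ i ∈ s, w i * b i * b i) < ε := by
    refine lt_of_le_of_lt (mul_le_mul_right (tsub_le_tsub_left ?_ 1) S) ht
    rw [Finset.sum_congr rfl hwbb, ← Finset.mul_sum]
    exact mul_le_mul_right hbsum t
  filter_upwards [hev1, hsumlim.eventually_lt_const hlim] with n hn1 hn2
  obtain ⟨π, hπ1, hπ2, hπ⟩ := exists_coupling_lintegral_le s (μs n) μ (φ := fun i x => φ i x) hφm
    (fun x => by exact_mod_cast hφ1 x) ht1 (fun i hi => (hn1 i hi).le) hwb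
    (c := fun z => ENNReal.ofReal (d z.1 z.2) ^ p)
    (ENNReal.continuous_rpow_const.comp (ENNReal.continuous_ofReal.comp hcont)).measurable
    (κ := ENNReal.ofReal (2 * r) ^ p)
    (fun i _ x y hx hy => ENNReal.rpow_le_rpow (ENNReal.ofReal_le_ofReal
      (hφd i x y (by exact_mod_cast hx) (by exact_mod_cast hy))) hp.le) hA hT hcA hAT
  exact ⟨π, hπ1, hπ2, hπ.trans (add_le_add hr.le
    (add_le_add (add_le_add hn2.le (hTμs n)) (add_le_add hn2.le hTμ)))⟩

end WassersteinOfWeak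

theorem real_rpow_add_le_mul_rpow_add_rpow {a b p : ℝ} (ha : 0 ≤ a) (hb : 0 ≤ b) (hp : 1 ≤ p) :
    (a + b) ^ p ≤ 2 ^ (p - 1) * (a ^ p + b ^ p) := by
  lift a to NNReal using ha
  lift b to NNReal using hb
  exact_mod_cast NNReal.rpow_add_le_mul_rpow_add_rpow a b hp

theorem tendsto_lintegral_sub_natCast {X : Type*} [MeasurableSpace X] (μ : Measure X)
    {g : X → ℝ} (hg : Measurable g) (h0 : ∀ x, 0 ≤ g x)
    (hfin : ∫⁻ x, ENNReal.ofReal (g x) ∂μ ≠ ∞) :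
    Tendsto (fun k : ℕ => ∫⁻ x, ENNReal.ofReal (max 0 (g x - k)) ∂μ) atTop (𝓝 0) := by
  rw [show (0 : ℝ≥0∞) = ∫⁻ _, 0 ∂μ by simp]
  refine tendsto_lintegral_of_dominated_convergence (fun x => ENNReal.ofReal (g x))
    (fun k => (measurable_const.max (hg.sub_const _)).ennreal_ofReal)
    (fun k => Eventually.of_forall fun x => ENNReal.ofReal_le_ofReal
      (max_le (h0 x) (sub_le_self _ k.cast_nonneg))) hfin (Eventually.of_forall fun x => ?_)
  refine tendsto_const_nhds.congr' ?_
  filter_upwards [tendsto_natCast_atTop_atTop.eventually_ge_atTop (g x)] with k hk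
  rw [max_eq_left (by linarith), ENNReal.ofReal_zero]

theorem wassersteinDist_le {E : Type*} [NormedAddCommGroup E] [NormedSpace ℝ E]
    [MeasurableSpace E] {C : ConvexCone ℝ E} {μ ν : ProbabilityMeasure C} {p : ℝ} (hp : 0 ≤ p)
    {π : ProbabilityMeasure (C × C)} (h₁ : (π : Measure (C × C)).map Prod.fst = μ)
    (h₂ : (π : Measure (C × C)).map Prod.snd = ν) {ε : ℝ≥0∞}
    (hπ : ∫⁻ z, ENNReal.ofReal (thompsonDist C z.1 z.2) ^ p ∂(π : Measure (C × C)) ≤ ε) :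
    wassersteinDist C p μ ν ≤ ε ^ (1 / p) :=
  ENNReal.rpow_le_rpow ((iInf₂_le π ⟨h₁, h₂⟩).trans hπ) (by positivity)

/-! ### Wasserstein convergence for the Thompson metric -/

section Wasserstein

variable {E : Type*} [NormedAddCommGroup E] [NormedSpace ℝ E] [MeasurableSpace E] [BorelSpace E]
  {C : ConvexCone ℝ E}

/-- The cost `d_T ^ p` is dominated by a sum of a function of each variable, whose tails are
uniformly small on a stochastically bounded set of measures with finite moments. -/
theorem exists_uniform_tail (hC : IsProperOpen C) (u : C) {p : ℝ} (hp : 1 ≤ p)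
    {ν₁ ν₂ : ProbabilityMeasure C} (h₁ : HasFiniteMoment C p ν₁) (h₂ : HasFiniteMoment C p ν₂)
    {ε : ℝ≥0∞} (hε : 0 < ε) :
    ∃ (A T : C → ℝ≥0∞) (S : ℝ≥0∞), Measurable A ∧ Measurable T ∧ S ≠ ∞ ∧
      (∀ x y, ENNReal.ofReal (thompsonDist C x y) ^ p ≤ A x + A y) ∧ (∀ x, A x ≤ S + T x) ∧
      ∀ ρ : ProbabilityMeasure C, StochLE C ν₁ ρ → StochLE C ρ ν₂ →
        ∫⁻ x, T x ∂(ρ : Measure C) ≤ ε := by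
  have hp0 : 0 ≤ p := zero_le_one.trans hp
  -- The convexity constant in (a + b)^p ≤ 2^(p-1) (a^p + b^p), applied to the triangle inequality
  -- through u.
  set L : ℝ := 2 ^ (p - 1) with hL
  have hL0 : 0 ≤ L := by positivity
  set f : C → ℝ := fun x => L * funkDist C x u ^ p with hf
  set g : C → ℝ := fun x => L * funkDist C u x ^ p with hg
  have hf0 : ∀ x, 0 ≤ f x := fun x => mul_nonneg hL0 (Real.rpow_nonneg (funkDist_nonneg _ _) _)
  have hg0 : ∀ x, 0 ≤ g x := fun x => mul_nonneg hL0 (Real.rpow_nonneg (funkDist_nonneg _ _) _)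
  have hfc : Continuous f := continuous_const.mul
    ((continuous_funkDist_left hC u).rpow_const fun _ => Or.inr hp0)
  have hgc : Continuous g := continuous_const.mul
    ((continuous_funkDist_right hC u).rpow_const fun _ => Or.inr hp0)
  have hfm : IsConeMonotone C f := fun x y h => mul_le_mul_of_nonneg_left
    (Real.rpow_le_rpow (funkDist_nonneg _ _) (funkDist_mono_left hC h u) hp0) hL0
  have hgm : ∀ ⦃x y : C⦄, ConeLE C (x : E) (y : E) → g y ≤ g x := fun x y h =>
    mul_le_mul_of_nonneg_left
      (Real.rpow_le_rpow (funkDist_nonneg _ _) (funkDist_anti_right hC h u) hp0) hL0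
  have hfin : ∀ (ρ : ProbabilityMeasure C), HasFiniteMoment C p ρ → ∀ k : C → ℝ,
      (∀ x, 0 ≤ k x) → (∀ x, k x ≤ thompsonDist C u x) →
      ∫⁻ x, ENNReal.ofReal (L * k x ^ p) ∂(ρ : Measure C) ≠ ∞ := by
    intro ρ hρ k hk0 hk
    refine ne_of_lt ?_
    calc ∫⁻ x, ENNReal.ofReal (L * k x ^ p) ∂(ρ : Measure C)
        ≤ ∫⁻ x, ENNReal.ofReal L * ENNReal.ofReal (thompsonDist C u x) ^ p ∂(ρ : Measure C) :=
          lintegral_mono fun x => by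
            rw [ENNReal.ofReal_mul hL0, ← ENNReal.ofReal_rpow_of_nonneg (hk0 x) hp0]
            gcongr
            exact hk x
      _ = ENNReal.ofReal L * ∫⁻ x, ENNReal.ofReal (thompsonDist C u x) ^ p ∂(ρ : Measure C) :=
          lintegral_const_mul' _ _ ENNReal.ofReal_ne_top
      _ < ∞ := ENNReal.mul_lt_top ENNReal.ofReal_lt_top (hρ u)
  have hlim := (tendsto_lintegral_sub_natCast (ν₂ : Measure C) hfc.measurable hf0
      (hfin ν₂ h₂ _ (fun x => funkDist_nonneg _ _) fun x => by
        rw [thompsonDist_eq_max_funkDist hC]; exact le_max_right _ _)).add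
    (tendsto_lintegral_sub_natCast (ν₁ : Measure C) hgc.measurable hg0
      (hfin ν₁ h₁ _ (fun x => funkDist_nonneg _ _) fun x => by
        rw [thompsonDist_eq_max_funkDist hC]; exact le_max_left _ _))
  rw [add_zero] at hlim
  -- The excess of f over k is monotone and that of g antitone, so one truncation level chosen for
  -- ν₂ and ν₁ serves every measure between them.
  obtain ⟨k, hk⟩ := (hlim.eventually_lt_const hε).exists
  have hfk : Continuous fun x => max 0 (f x - k) := continuous_const.max (hfc.sub continuous_const)
  have hgk : Continuous fun x => max 0 (g x - k) := continuous_const.max (hgc.sub continuous_const)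
  refine ⟨fun x => ENNReal.ofReal (f x) + ENNReal.ofReal (g x),
    fun x => ENNReal.ofReal (max 0 (f x - k)) + ENNReal.ofReal (max 0 (g x - k)),
    ENNReal.ofReal k + ENNReal.ofReal k,
    hfc.measurable.ennreal_ofReal.add hgc.measurable.ennreal_ofReal,
    hfk.measurable.ennreal_ofReal.add hgk.measurable.ennreal_ofReal, by simp, fun x y => ?_,
    fun x => ?_, fun ρ hρ₁ hρ₂ => ?_⟩
  · have hD : ∀ z, thompsonDist C u z ^ p ≤ funkDist C z u ^ p + funkDist C u z ^ p := fun z => by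
      have n1 := Real.rpow_nonneg (funkDist_nonneg (C := C) z u) p
      have n2 := Real.rpow_nonneg (funkDist_nonneg (C := C) u z) p
      rw [thompsonDist_eq_max_funkDist hC]
      rcases max_choice (funkDist C u z) (funkDist C z u) with h | h <;> rw [h] <;> linarith
    have key : thompsonDist C x y ^ p ≤ (f x + g x) + (f y + g y) := by
      have d1 := thompsonDist_nonneg hC u x
      have d2 := thompsonDist_nonneg hC u y
      calc thompsonDist C x y ^ p ≤ (thompsonDist C u x + thompsonDist C u y) ^ p := by
            refine Real.rpow_le_rpow (thompsonDist_nonneg hC _ _) ?_ hp0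
            rw [thompsonDist_comm u x]
            exact thompsonDist_triangle hC x u y
        _ ≤ L * (thompsonDist C u x ^ p + thompsonDist C u y ^ p) :=
            real_rpow_add_le_mul_rpow_add_rpow d1 d2 hp
        _ ≤ L * ((funkDist C x u ^ p + funkDist C u x ^ p) +
              (funkDist C y u ^ p + funkDist C u y ^ p)) :=
            mul_le_mul_of_nonneg_left (add_le_add (hD x) (hD y)) hL0
        _ = _ := by simp only [hf, hg]; ring
    change _ ≤ (ENNReal.ofReal (f x) + ENNReal.ofReal (g x)) +
      (ENNReal.ofReal (f y) + ENNReal.ofReal (g y))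
    rw [ENNReal.ofReal_rpow_of_nonneg (thompsonDist_nonneg hC _ _) hp0,
      ← ENNReal.ofReal_add (hf0 x) (hg0 x), ← ENNReal.ofReal_add (hf0 y) (hg0 y),
      ← ENNReal.ofReal_add (add_nonneg (hf0 x) (hg0 x)) (add_nonneg (hf0 y) (hg0 y))]
    exact ENNReal.ofReal_le_ofReal key
  · have hle : ∀ t : ℝ, ENNReal.ofReal t ≤ ENNReal.ofReal k + ENNReal.ofReal (max 0 (t - k)) :=
      fun t => by
        rw [← ENNReal.ofReal_add k.cast_nonneg (le_max_left _ _)]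
        exact ENNReal.ofReal_le_ofReal (by linarith [le_max_right 0 (t - k)])
    exact (add_le_add (hle _) (hle _)).trans_eq (add_add_add_comm _ _ _ _)
  · rw [lintegral_add_left hfk.measurable.ennreal_ofReal]
    refine (add_le_add ?_ ?_).trans hk.le
    · exact hρ₂.lintegral_mono hfk (fun _ => le_max_left _ _)
        fun x y h => max_le_max le_rfl (sub_le_sub_right (hfm h) _)
    · exact hρ₁.lintegral_anti hC hgk (fun _ => le_max_left _ _)
        fun x y h => max_le_max le_rfl (sub_le_sub_right (hgm h) _)

/-- Weak convergence of a stochastically bounded sequence, with finite moments of the bounds,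
implies convergence in the Wasserstein distance. -/
theorem tendsto_wassersteinDist [FiniteDimensional ℝ E] (hC : IsProperOpen C) (u : C) {p : ℝ}
    (hp : 1 ≤ p) {ν₁ ν₂ μ : ProbabilityMeasure C} {μs : ℕ → ProbabilityMeasure C}
    (h₁ : HasFiniteMoment C p ν₁) (h₂ : HasFiniteMoment C p ν₂)
    (hμ₁ : StochLE C ν₁ μ) (hμ₂ : StochLE C μ ν₂)
    (hμs₁ : ∀ n, StochLE C ν₁ (μs n)) (hμs₂ : ∀ n, StochLE C (μs n) ν₂)
    (hμ : Tendsto μs atTop (𝓝 μ)) :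
    Tendsto (fun n => wassersteinDist C p (μs n) μ) atTop (𝓝 0) := by
  have hp0 : 0 < p := zero_lt_one.trans_le hp
  have : CompleteSpace E := FiniteDimensional.complete ℝ E
  have : ProperSpace E := FiniteDimensional.proper ℝ E
  have : PolishSpace C := hC.isOpen.polishSpace
  -- The coupling costs at most 5ε: one ε near the diagonal and, for each marginal, one for the
  -- bounded part and one for the tail.
  have hcont : Tendsto (fun ε : ℝ≥0∞ => (5 * ε) ^ (1 / p)) (𝓝 0) (𝓝 0) := by
    have := (ENNReal.continuous_rpow_const (y := 1 / p)).tendsto (5 * 0) |>.comp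
      (ENNReal.Tendsto.const_mul (tendsto_id (x := 𝓝 (0 : ℝ≥0∞)))
        (Or.inr (ENNReal.ofNat_ne_top (n := 5))))
    rwa [mul_zero, ENNReal.zero_rpow_of_pos (by positivity)] at this
  rw [ENNReal.tendsto_nhds_zero]
  intro δ hδ
  obtain ⟨ε, hεδ, hε⟩ := ((eventually_nhdsWithin_of_eventually_nhds
    (hcont.eventually_lt_const hδ)).and
      (self_mem_nhdsWithin (a := (0 : ℝ≥0∞)) (s := Set.Ioi 0))).exists
  obtain ⟨A, T, S, hA, hT, hS, hcA, hAT, hρ⟩ := exists_uniform_tail hC u hp h₁ h₂ hε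
  filter_upwards [eventually_exists_coupling (thompsonDist_self hC) thompsonDist_comm
    (thompsonDist_triangle hC) (continuous_thompsonDist hC) hp0 hμ hε hA hT hS hcA hAT
    (hρ μ hμ₁ hμ₂) fun n => hρ _ (hμs₁ n) (hμs₂ n)] with n hn
  obtain ⟨π, hπ₁, hπ₂, hπ⟩ := hn
  refine (wassersteinDist_le hp0.le hπ₁ hπ₂ (hπ.trans_eq ?_)).trans hεδ.le
  ring

/-- Convergence in the Wasserstein distance implies weak convergence. -/
theorem tendsto_of_tendsto_wassersteinDist [FiniteDimensional ℝ E] (hC : IsProperOpen C) {p : ℝ}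
    (hp : 0 < p) {μ : ProbabilityMeasure C} {μs : ℕ → ProbabilityMeasure C}
    (h : Tendsto (fun n => wassersteinDist C p (μs n) μ) atTop (𝓝 0)) :
    Tendsto μs atTop (𝓝 μ) := by
  have hcost : Tendsto (fun n => ⨅ π ∈ couplings C (μs n) μ,
      ∫⁻ z, ENNReal.ofReal (thompsonDist C z.1 z.2) ^ p ∂(π : Measure (C × C))) atTop (𝓝 0) := by
    have := (ENNReal.continuous_rpow_const (y := p)).tendsto 0 |>.comp h
    rw [ENNReal.zero_rpow_of_pos hp] at this
    refine this.congr fun n => ?_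
    simp only [Function.comp_apply, wassersteinDist]
    rw [← ENNReal.rpow_mul, one_div, inv_mul_cancel₀ hp.ne', ENNReal.rpow_one]
  refine tendsto_of_forall_isOpen_le_liminf' fun G hG => ?_
  -- Points of Thompson distance at least 1/(k+1) from the complement of G. They exhaust G because
  -- the Thompson topology is at least as fine as the given one.
  set F : ℕ → Set C := fun k => {x | ∀ y ∉ G, 1 / ((k : ℝ) + 1) ≤ thompsonDist C x y} with hF
  have hFc : ∀ k, IsClosed (F k) := fun k => by
    have : F k = ⋂ y ∈ Gᶜ, {x | 1 / ((k : ℝ) + 1) ≤ thompsonDist C x y} := by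
      ext x; simp [hF]
    rw [this]
    exact isClosed_biInter fun y _ => isClosed_le continuous_const
      (continuous_thompsonDist_left hC y)
  have hmono : Monotone F := fun k l hkl x hx y hy =>
    (one_div_le_one_div_of_le (by positivity) (by gcongr)).trans (hx y hy)
  have hunion : ⋃ k, F k = G := by
    ext x
    rw [Set.mem_iUnion]
    constructor
    · rintro ⟨k, hk⟩
      by_contra hx
      have := hk x hx
      rw [thompsonDist_self hC] at this
      exact absurd this (not_le.2 (by positivity))
    · intro hx
      obtain ⟨ε, hε, hεG⟩ := exists_pos_le_thompsonDist hC hG hx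
      obtain ⟨k, hk⟩ := exists_nat_one_div_lt hε
      exact ⟨k, fun y hy => hk.le.trans (hεG y hy)⟩
  have hlim : Tendsto (fun k => (μ : Measure C) (F k)) atTop (𝓝 ((μ : Measure C) G)) := by
    rw [← hunion]; exact tendsto_measure_iUnion_atTop hmono
  refine le_of_forall_lt fun b hb => ?_
  obtain ⟨b', hbb', hb'⟩ := exists_between hb
  refine hbb'.trans_le ?_
  obtain ⟨k, hk⟩ := (hlim.eventually_const_lt hb').exists
  set q : ℝ≥0∞ := ENNReal.ofReal (1 / ((k : ℝ) + 1)) ^ p with hq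
  have hq0 : q ≠ 0 := (ENNReal.rpow_pos (ENNReal.ofReal_pos.2 (by positivity))
    ENNReal.ofReal_ne_top).ne'
  have hqt : q ≠ ∞ := ENNReal.rpow_ne_top_of_nonneg hp.le ENNReal.ofReal_ne_top
  set η : ℝ≥0∞ := (μ : Measure C) (F k) - b' with hη
  have hη0 : η ≠ 0 := (tsub_pos_of_lt hk).ne'
  refine le_liminf_of_le (by isBoundedDefault) ?_
  -- A coupling of cost below η q moves points by 1/(k+1) or more with probability at most η, by
  -- Markov; only such moves lead from outside G into the k-th set.
  filter_upwards [hcost.eventually_lt_const (ENNReal.mul_pos hη0 hq0)] with n hn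
  simp only [iInf_lt_iff] at hn
  obtain ⟨π, ⟨hπ₁, hπ₂⟩, hπ⟩ := hn
  have hdm : Measurable fun z : C × C => ENNReal.ofReal (thompsonDist C z.1 z.2) ^ p := by
    have : SecondCountableTopology E := by
      have : ProperSpace E := FiniteDimensional.proper ℝ E
      infer_instance
    exact (ENNReal.continuous_rpow_const.comp
      (ENNReal.continuous_ofReal.comp (continuous_thompsonDist hC))).measurable
  have hmarkov : (π : Measure (C × C))
      {z | q ≤ ENNReal.ofReal (thompsonDist C z.1 z.2) ^ p} ≤ η :=
    (meas_ge_le_lintegral_div hdm.aemeasurable hq0 hqt).trans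
      (ENNReal.div_le_of_le_mul hπ.le)
  have hsub : Prod.snd ⁻¹' F k ⊆ Prod.fst ⁻¹' G ∪
      {z : C × C | q ≤ ENNReal.ofReal (thompsonDist C z.1 z.2) ^ p} := by
    rintro ⟨x, y⟩ hy
    by_cases hx : x ∈ G
    · exact Or.inl hx
    · refine Or.inr (ENNReal.rpow_le_rpow (ENNReal.ofReal_le_ofReal ?_) hp.le)
      rw [thompsonDist_comm]
      exact hy x hx
  have hle : (μ : Measure C) (F k) ≤ (μs n : Measure C) G + η := by
    rw [← hπ₁, ← hπ₂, Measure.map_apply measurable_snd (hFc k).measurableSet,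
      Measure.map_apply measurable_fst hG.measurableSet]
    exact (measure_mono hsub).trans ((measure_union_le _ _).trans (add_le_add le_rfl hmarkov))
  calc b' = (μ : Measure C) (F k) - η :=
        (ENNReal.sub_sub_cancel (measure_ne_top _ _) hk.le).symm
    _ ≤ (μs n : Measure C) G := tsub_le_iff_right.2 hle

end Wasserstein

end ConeOrder

end

theorem corollary6p5 {E : Type*} [NormedAddCommGroup E] [NormedSpace ℝ E]
    [FiniteDimensional ℝ E] [MeasurableSpace E] [BorelSpace E]
    (C : ConvexCone ℝ E) (hC_open : IsOpen (C : Set E))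
    (hC_proper : closure (C : Set E) ∩ {x | -x ∈ closure (C : Set E)} = {0})
    (μ : ProbabilityMeasure C) (μs : ℕ → ProbabilityMeasure C) :
    -- increasing case
    (((∀ n, ConeOrder.StochLE C (μs n) (μs (n + 1))) ∧ Tendsto μs atTop (𝓝 μ)) ↔
      ∀ f : C →ᵇ ℝ, (∀ x, 0 ≤ f x) → ConeOrder.IsConeMonotone C f →
        Monotone (fun n => ∫ x, f x ∂(μs n : Measure C)) ∧
        Tendsto (fun n => ∫ x, f x ∂(μs n : Measure C)) atTop
          (𝓝 (∫ x, f x ∂(μ : Measure C)))) ∧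
    -- decreasing case
    (((∀ n, ConeOrder.StochLE C (μs (n + 1)) (μs n)) ∧ Tendsto μs atTop (𝓝 μ)) ↔
      ∀ f : C →ᵇ ℝ, (∀ x, 0 ≤ f x) → ConeOrder.IsConeMonotone C f →
        Antitone (fun n => ∫ x, f x ∂(μs n : Measure C)) ∧
        Tendsto (fun n => ∫ x, f x ∂(μs n : Measure C)) atTop
          (𝓝 (∫ x, f x ∂(μ : Measure C)))) ∧
    -- equivalence with monotone Wasserstein convergence
    (∀ p : ℝ, 1 ≤ p → ConeOrder.HasFiniteMoment C p μ →
      (∀ n, ConeOrder.HasFiniteMoment C p (μs n)) →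
      (((∀ n, ConeOrder.StochLE C (μs n) (μs (n + 1))) ∧ Tendsto μs atTop (𝓝 μ)) ↔
        ((∀ n, ConeOrder.StochLE C (μs n) (μs (n + 1))) ∧
          Tendsto (fun n => ConeOrder.wassersteinDist C p (μs n) μ) atTop (𝓝 0))) ∧
      (((∀ n, ConeOrder.StochLE C (μs (n + 1)) (μs n)) ∧ Tendsto μs atTop (𝓝 μ)) ↔
        ((∀ n, ConeOrder.StochLE C (μs (n + 1)) (μs n)) ∧
          Tendsto (fun n => ConeOrder.wassersteinDist C p (μs n) μ) atTop (𝓝 0)))) := by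
  have hzero : (0 : E) ∈ closure (C : Set E) := (hC_proper.ge rfl).1
  have hC : ConeOrder.IsProperOpen C :=
    ⟨hC_open, hzero, fun x hx hx' => hC_proper.le ⟨hx, hx'⟩⟩
  obtain ⟨u, hu⟩ : (C : Set E).Nonempty := closure_nonempty_iff.1 ⟨0, hzero⟩
  refine ⟨ConeOrder.monotone_tendsto_iff hC ⟨⟨u, hu⟩⟩ μ μs,
    ConeOrder.antitone_tendsto_iff hC ⟨⟨u, hu⟩⟩ μ μs, fun p hp hμ hμs => ⟨?_, ?_⟩⟩
  · refine and_congr_right fun hm => ⟨fun h => ?_,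
      ConeOrder.tendsto_of_tendsto_wassersteinDist hC (zero_lt_one.trans_le hp)⟩
    -- The whole sequence and its limit lie between the first measure and μ, both with finite
    -- moments; in the decreasing case the two bounds exchange roles.
    have hle := ConeOrder.StochLE.le_of_tendsto_of_monotone hC hm h
    exact ConeOrder.tendsto_wassersteinDist hC ⟨u, hu⟩ hp (hμs 0) hμ (hle 0) (fun _ _ _ => le_rfl)
      (ConeOrder.StochLE.of_le_succ hm) hle h
  · refine and_congr_right fun hm => ⟨fun h => ?_,
      ConeOrder.tendsto_of_tendsto_wassersteinDist hC (zero_lt_one.trans_le hp)⟩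
    have hge := ConeOrder.StochLE.ge_of_tendsto_of_antitone hC hm h
    exact ConeOrder.tendsto_wassersteinDist hC ⟨u, hu⟩ hp hμ (hμs 0) (fun _ _ _ => le_rfl) (hge 0)
      hge (ConeOrder.StochLE.of_succ_le hm) h
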